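/- Let $d\in\mathbb N$, $1\le\alpha<2$. Let $M:\mathbb R^d\to(0,\infty)$ be twice differentiable with $M(-v)=M(v)$, $\int_{\mathbb R^d} M\,dv=1$, $|v|^{d+\alpha}M(v)\to\gamma$ as $|v|\to\infty$ for some $\gamma>0$, and, for some constant $C$ and all $v$, $$|D_vM(v)|\le C\frac{M(v)}{1+|v|},\qquad |D_v^2M(v)|\le C\,M(v).$$ Let $\sigma:\mathbb R^d\times\mathbb R^d\to\mathbb R$ be such that $\sigma(v,v')=\sigma(v',v)$ and $\nu_1\le\sigma(v,v')\le\nu_2$ for some constants $0<\nu_1\le\nu_2$, such that $v\mapsto\sigma(v',v)$ is $C^1$ for every $v'$ with $|\nabla_v\sigma(v',v)|\le \frac{C}{1+|v|}$ for all $v,v'$, such that $\nu(v):=\int\sigma(v',v)M(v')\,dv'$ is even, and such that, for some $\nu_0$, $|\sigma(v,v')-\nu_0|\le\frac{C}{1+|v|}$ for all $v,v'$. Set $$Q(f)(v)=\int_{\mathbb R^d}\big(\sigma(v,v')M(v)f(v')-\sigma(v',v)M(v')f(v)\big)\,dv'.$$ Then there is a function $F:\mathbb R^d\times\mathbb R^d\to\mathbb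 R$, $(v,E)\mapsto F(v,E)$, with the following properties. (i) For every $E\in\mathbb R^d$, the function $F(\cdot,E)$ is of class $C^1$, belongs to $L^2(\mathbb R^d, M^{-1}dv)\cap L^1(\mathbb R^d)$, and solves $$E\cdot\nabla_vF-Q(F)=0,\qquad \int_{\mathbb R^d}F(v,E)\,dv=1,$$ pointwise and in the sense of distributions. It is the unique such solution: every $f\in L^1(\mathbb R^d)$ (in particular every $f\in L^2(\mathbb R^d,M^{-1}dv)$) with $\int f\,dv=1$ and $E\cdot\nabla_vf-Q(f)=0$ in the sense of distributions is equal to $F(\cdot,E)$ almost everywhere. (ii) For every $R>0$ there are constants $c(R),C(R)>0$ such that $c(R)M(v)\le F(v,E)\le C(R)M(v)$ for all $v\in\mathbb R^d$ and all $|E|\le R$. (iii) For every $v\in\mathbb R^d$ the function $E\mapsto F(v,E)$ is $C^1$ on $\mathbb R^d$, and for every $R>0$ there is $C(R)>0$ such that $$|\partial_EF(v,E)|\le C(R)\frac{F(v,E)}{1+|v|}\qquad\text{for all } v\in\mathbb R^d,\ |E|\le R.$$ -/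

import Mathlib

open MeasureTheory Filter Topology
open scoped ContDiff

namespace LinearBoltzmann

/-- The velocity space `ℝ^d` with its Euclidean norm and Lebesgue measure. -/
abbrev Vel (d : ℕ) : Type := EuclideanSpace ℝ (Fin d)

/-- The linear Boltzmann operator
`Q(f)(v) = ∫ (σ(v,v') M(v) f(v') - σ(v',v) M(v') f(v)) dv'`. -/
noncomputable def collision {d : ℕ} (M : Vel d → ℝ) (σ : Vel d → Vel d → ℝ)
    (f : Vel d → ℝ) (v : Vel d) : ℝ :=
  ∫ v', (σ v v' * M v * f v' - σ v' v * M v' * f v)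

/-- The collision frequency `ν(v) = ∫ σ(v',v) M(v') dv'`. -/
noncomputable def collisionFrequency {d : ℕ} (M : Vel d → ℝ) (σ : Vel d → Vel d → ℝ)
    (v : Vel d) : ℝ :=
  ∫ v', σ v' v * M v'

/-- The assumptions on the heavy-tailed equilibrium `M`: a positive even probability density,
with `|v|^(d+α) M(v) → γ > 0` at infinity, twice differentiable, with
`|DM| ≤ C M / (1+|v|)` and `|D²M| ≤ C M`. -/
structure IsHeavyTailEquilibrium {d : ℕ} (α : ℝ) (M : Vel d → ℝ) : Prop where
  pos : ∀ v, 0 < M v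
  even : ∀ v, M (-v) = M v
  integral_eq_one : (∫ v, M v) = 1
  tail : ∃ γ : ℝ, 0 < γ ∧
    Tendsto (fun v : Vel d => ‖v‖ ^ ((d : ℝ) + α) * M v) (cocompact (Vel d)) (𝓝 γ)
  differentiable : Differentiable ℝ M
  differentiable_fderiv : Differentiable ℝ (fderiv ℝ M)
  fderiv_bound : ∃ C : ℝ, ∀ v, ‖fderiv ℝ M v‖ ≤ C * (M v / (1 + ‖v‖))
  fderiv_fderiv_bound : ∃ C : ℝ, ∀ v, ‖fderiv ℝ (fderiv ℝ M) v‖ ≤ C * M v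

/-- The assumptions on the cross section `σ` (relative to `M`): symmetric, bounded between two
positive constants, of class `C¹` with respect to the velocity and with
`|∇_v σ(v',v)| ≤ C / (1+|v|)`, with even collision frequency, and with
`|σ(v,v') - ν₀| ≤ C / (1+|v|)` for some constant `ν₀`. -/
structure IsCrossSection {d : ℕ} (M : Vel d → ℝ) (σ : Vel d → Vel d → ℝ) : Prop where
  symm : ∀ v v', σ v v' = σ v' v
  bounds : ∃ ν₁ ν₂ : ℝ, 0 < ν₁ ∧ ∀ v v', ν₁ ≤ σ v v' ∧ σ v v' ≤ ν₂
  contDiff : ∀ v', ContDiff ℝ 1 (fun v => σ v' v)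
  fderiv_bound : ∃ C : ℝ, ∀ v' v, ‖fderiv ℝ (fun w => σ v' w) v‖ ≤ C / (1 + ‖v‖)
  frequency_even : ∀ v, collisionFrequency M σ (-v) = collisionFrequency M σ v
  limit : ∃ ν₀ C : ℝ, ∀ v v', |σ v v' - ν₀| ≤ C / (1 + ‖v‖)

/-- `f` is an integrable solution, in the sense of distributions, of
`E · ∇_v f - Q(f) = 0`, with `∫ f = 1`. Here `fderiv ℝ φ v E` is `E · ∇_v φ(v)`.
Every function of the weighted space `L²(M⁻¹ dv)` is integrable, so this class contains all the
normalized solutions in that space. -/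
structure IsNormalizedSolution {d : ℕ} (M : Vel d → ℝ) (σ : Vel d → Vel d → ℝ) (E : Vel d)
    (f : Vel d → ℝ) : Prop where
  integrable : Integrable f
  integral_eq_one : (∫ v, f v) = 1
  equation : ∀ φ : Vel d → ℝ, ContDiff ℝ ∞ φ → HasCompactSupport φ →
    -(∫ v, f v * fderiv ℝ φ v E) - (∫ v, collision M σ f v * φ v) = 0

end LinearBoltzmann

/-!
Write `ν` for the collision frequency and `gain f v = ∫ σ(v,v') f(v') dv'`. The equation reads
`E · ∇F + ν F = M gain F`, and Duhamel's formula along the trajectories `v - tE` inverts its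
left-hand side by an operator `R_E`. For a normalized `F` and any constant `c`, it is thus the
fixed-point problem
`F = c R_E M + ∫ K_E(·, u) F(u) du`, with `K_E(·, u) = R_E (M (σ(·, u) - c))`.

With `c = ν₁ ≤ σ` the kernel is nonnegative and contracts `L¹(ν dv)` by the factor `1 - ν₁ / ν₂`,
so `F` is the sum of a Neumann series, and `F ≥ ν₁ R_E M`. The bounds on `DM` make `M(v - tE)` at
most a polynomial in `t` times `M(v)`; the absorption `exp (-ν₁ t)` beats it, so `R_E` preserves
the order of magnitude of `M`, and so does its derivative in `E`. With `c = ν₀` both terms of the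
fixed-point problem have an `E`-derivative of order `M / (1 + |v|)`, which gives (iii).

For uniqueness, the difference `w` of two normalized solutions satisfies
`E · ∇w + ν₂ w = ν₂ w + Q w`, whose right-hand side has `L¹` norm at most `(ν₂ - ν₁) ‖w‖₁` because
`∫ w = 0`, whereas the transport equation gives `ν₂ ‖w‖₁ ≤ ‖ν₂ w + Q w‖₁`.
-/

namespace LinearBoltzmann

section DifferentiationUnderIntegral

variable {X P : Type*} [TopologicalSpace X] [MeasurableSpace X] [OpensMeasurableSpace X]
  {μ : Measure X} [NormedAddCommGroup P] [NormedSpace ℝ P] [FiniteDimensional ℝ P]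

theorem aestronglyMeasurable_fderiv_of_continuous {f : P → X → ℝ} (hf : Continuous f.uncurry)
    (p : P) : AEStronglyMeasurable (fun x => fderiv ℝ (f · x) p) μ := by
  borelize P
  have : ProperSpace P := FiniteDimensional.proper_real P
  have hf' : Continuous (Function.uncurry fun x p => f p x) := hf.comp continuous_swap
  exact ((measurable_fderiv_with_param ℝ hf').comp
    (measurable_id.prodMk measurable_const)).aestronglyMeasurable

theorem contDiff_one_integral_of_continuous {f : P → X → ℝ}
    (hf : Continuous f.uncurry) (hd : ∀ᵐ x ∂μ, ContDiff ℝ 1 (f · x))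
    (hb : ∀ R, ∃ b : X → ℝ, Integrable b μ ∧ ∀ᵐ x ∂μ, ∀ p, ‖p‖ ≤ R →
      |f p x| ≤ b x ∧ ‖fderiv ℝ (f · x) p‖ ≤ b x) :
    ContDiff ℝ 1 (fun p => ∫ x, f p x ∂μ) ∧
      ∀ p, fderiv ℝ (fun p => ∫ x, f p x ∂μ) p = ∫ x, fderiv ℝ (f · x) p ∂μ := by
  have hmeas : ∀ p, AEStronglyMeasurable (f p) μ := fun p =>
    (hf.comp (Continuous.prodMk_right p)).aestronglyMeasurable
  have hmeas' : ∀ p, AEStronglyMeasurable (fun x => fderiv ℝ (f · x) p) μ :=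
    aestronglyMeasurable_fderiv_of_continuous hf
  have hnhds : ∀ p₀ : P, Metric.closedBall 0 (‖p₀‖ + 1) ∈ 𝓝 p₀ := fun p₀ =>
    Filter.mem_of_superset (Metric.closedBall_mem_nhds p₀ one_pos)
      (Metric.closedBall_subset_closedBall' (by rw [dist_zero_right, add_comm]))
  have hder : ∀ p, HasFDerivAt (fun p => ∫ x, f p x ∂μ) (∫ x, fderiv ℝ (f · x) p ∂μ) p := by
    intro p
    obtain ⟨b, hbi, hbd⟩ := hb (‖p‖ + 1)
    refine hasFDerivAt_integral_of_dominated_of_fderiv_le (hnhds p) (Eventually.of_forall hmeas)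
      (hbi.mono' (hmeas p) (hbd.mono fun x hx => (hx p (by linarith)).1)) (hmeas' p)
      (hbd.mono fun x hx q hq => (hx q (by simpa using hq)).2) hbi
      (hd.mono fun x hx q _ => (hx.differentiable one_ne_zero q).hasFDerivAt)
  refine ⟨contDiff_one_iff_fderiv.2 ⟨fun p => (hder p).differentiableAt, ?_⟩,
    fun p => (hder p).fderiv⟩
  rw [funext fun p => (hder p).fderiv]
  refine continuous_iff_continuousAt.2 fun p => ?_
  obtain ⟨b, hbi, hbd⟩ := hb (‖p‖ + 1)
  refine continuousAt_of_dominated (Eventually.of_forall hmeas') ?_ hbi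
    (hd.mono fun x hx => (hx.continuous_fderiv one_ne_zero).continuousAt)
  filter_upwards [hnhds p] with q hq
  exact hbd.mono fun x hx => (hx q (by simpa using hq)).2

end DifferentiationUnderIntegral

theorem integrableOn_exp_neg_mul_one_add_pow {a : ℝ} (ha : 0 < a) (n : ℕ) :
    IntegrableOn (fun t : ℝ => Real.exp (-(a * t)) * (1 + t) ^ n) (Set.Ioi 0) := by
  refine integrable_of_isBigO_exp_neg (half_pos ha) (by fun_prop) ?_
  have hpow : (fun t : ℝ => (1 + t) ^ n) =O[atTop] fun t => Real.exp (a / 2 * t) := by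
    refine .trans (.of_bound (2 ^ n) ?_) (isLittleO_pow_exp_pos_mul_atTop n (half_pos ha)).isBigO
    filter_upwards [eventually_ge_atTop 1] with t ht
    rw [Real.norm_of_nonneg (by positivity), Real.norm_of_nonneg (by positivity), ← mul_pow]
    gcongr
    linarith
  refine ((Asymptotics.isBigO_refl (fun t : ℝ => Real.exp (-(a * t))) atTop).mul hpow).congr_right
    fun t => ?_
  rw [← Real.exp_add]
  congr 1
  ring

section ModerateWeight

variable {V : Type*} [NormedAddCommGroup V]

/-- A moderate weight: a positive function which a translation by `w` multiplies by at most a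
fixed polynomial in `‖w‖`. -/
structure IsModerateWeight (m : V → ℝ) : Prop where
  pos : ∀ v, 0 < m v
  exists_sub_le : ∃ (A : ℝ) (k : ℕ), ∀ v w, m (v - w) ≤ A * (1 + ‖w‖) ^ k * m v

theorem one_add_norm_le_mul (v w : V) : 1 + ‖v‖ ≤ (1 + ‖v - w‖) * (1 + ‖w‖) := by
  nlinarith [norm_sub_norm_le v w, norm_nonneg (v - w), norm_nonneg w, norm_nonneg v]

theorem inv_one_add_norm_sub_le (v w : V) : (1 + ‖v - w‖)⁻¹ ≤ (1 + ‖w‖) / (1 + ‖v‖) := by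
  rw [inv_le_comm₀ (by positivity) (by positivity), inv_div, div_le_iff₀ (by positivity)]
  exact one_add_norm_le_mul v w

namespace IsModerateWeight

variable {m : V → ℝ} (hm : IsModerateWeight m)
include hm

theorem exists_pos_sub_le :
    ∃ (A : ℝ) (k : ℕ), 0 < A ∧ ∀ v w, m (v - w) ≤ A * (1 + ‖w‖) ^ k * m v := by
  obtain ⟨A, k, hA⟩ := hm.exists_sub_le
  exact ⟨A, k, by simpa [hm.pos 0] using (hm.pos (0 - 0)).trans_le (hA 0 0), hA⟩

theorem div_one_add_norm : IsModerateWeight fun v => m v / (1 + ‖v‖) := by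
  obtain ⟨A, k, hA⟩ := hm.exists_sub_le
  refine ⟨fun v => div_pos (hm.pos v) (by positivity), A, k + 1, fun v w => ?_⟩
  calc m (v - w) / (1 + ‖v - w‖) = m (v - w) * (1 + ‖v - w‖)⁻¹ := div_eq_mul_inv _ _
    _ ≤ A * (1 + ‖w‖) ^ k * m v * ((1 + ‖w‖) / (1 + ‖v‖)) :=
      mul_le_mul (hA v w) (inv_one_add_norm_sub_le v w) (by positivity)
        ((hm.pos _).le.trans (hA v w))
    _ = A * (1 + ‖w‖) ^ (k + 1) * (m v / (1 + ‖v‖)) := by ring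

theorem exists_le_of_norm_le (R : ℝ) : ∃ B, 0 < B ∧ ∀ v, ‖v‖ ≤ R → m v ≤ B := by
  obtain ⟨A, k, hA0, hA⟩ := hm.exists_pos_sub_le
  have h0 := hm.pos 0
  refine ⟨A * (1 + |R|) ^ k * m 0, by positivity, fun v hv => ?_⟩
  have h := hA 0 (-v)
  rw [sub_neg_eq_add, zero_add, norm_neg] at h
  refine h.trans ?_
  gcongr
  exact hv.trans (le_abs_self R)

end IsModerateWeight

variable [NormedSpace ℝ V]

theorem norm_sub_map_zero_le_log {g : V → ℝ} {C : ℝ} (hg : Differentiable ℝ g)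
    (hC : ∀ v, ‖fderiv ℝ g v‖ ≤ C / (1 + ‖v‖)) (x : V) :
    ‖g x - g 0‖ ≤ C * Real.log (1 + ‖x‖) := by
  have hpath : ∀ s : ℝ, HasDerivAt (fun s : ℝ => g (s • x) - g 0) (fderiv ℝ g (s • x) x) s :=
    fun s => by
      have h := (hg (s • x)).hasFDerivAt.comp_hasDerivAt s ((hasDerivAt_id s).smul_const x)
      simpa using h.sub_const (g 0)
  have hbarrier : ∀ s : ℝ, 0 ≤ s → HasDerivAt (fun s => C * Real.log (1 + s * ‖x‖))
      (C * (‖x‖ / (1 + s * ‖x‖))) s := fun s hs => by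
    have h := (((hasDerivAt_id s).mul_const ‖x‖).const_add 1).log
      (by have := norm_nonneg x; simp only [id]; positivity)
    simpa using h.const_mul C
  have h := image_norm_le_of_norm_deriv_right_le_deriv_boundary' (a := 0) (b := 1)
    (fun s _ => (hpath s).continuousAt.continuousWithinAt)
    (fun s _ => (hpath s).hasDerivWithinAt) (by simp)
    (fun s hs => (hbarrier s hs.1).continuousAt.continuousWithinAt)
    (fun s hs => (hbarrier s hs.1).hasDerivWithinAt) (fun s hs => ?_)
    (Set.right_mem_Icc.2 zero_le_one)
  · simpa using h
  · calc ‖fderiv ℝ g (s • x) x‖ ≤ C / (1 + ‖s • x‖) * ‖x‖ :=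
          (fderiv ℝ g (s • x)).le_of_opNorm_le (hC _) x
      _ = C * (‖x‖ / (1 + s * ‖x‖)) := by
          rw [norm_smul, Real.norm_of_nonneg hs.1]
          ring

theorem norm_map_sub_sub_map_le_of_two_mul_norm_le {g : V → ℝ} {C : ℝ} (hg : Differentiable ℝ g)
    (hC : ∀ v, ‖fderiv ℝ g v‖ ≤ C / (1 + ‖v‖)) {v w : V} (hvw : 2 * ‖w‖ ≤ ‖v‖) :
    ‖g (v - w) - g v‖ ≤ C := by
  have hC0 : 0 ≤ C := by simpa using (norm_nonneg _).trans (hC 0)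
  have hball : ∀ y ∈ Metric.closedBall v ‖w‖, ‖fderiv ℝ g y‖ ≤ 2 * C / (1 + ‖v‖) := by
    intro y hy
    have hy' : ‖v‖ - ‖w‖ ≤ ‖y‖ := by
      have := norm_sub_norm_le v y
      rw [mem_closedBall_iff_norm'] at hy
      linarith
    refine (hC y).trans ?_
    rw [div_le_div_iff₀ (by positivity) (by positivity)]
    nlinarith
  have h := (convex_closedBall v ‖w‖).norm_image_sub_le_of_norm_fderiv_le (fun y _ => hg y) hball
    (Metric.mem_closedBall_self (norm_nonneg w)) (y := v - w) (by simp)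
  refine h.trans ?_
  rw [sub_sub_cancel_left, norm_neg, div_mul_eq_mul_div, div_le_iff₀ (by positivity)]
  nlinarith

theorem norm_map_sub_sub_map_le_log {g : V → ℝ} {C : ℝ} (hg : Differentiable ℝ g)
    (hC : ∀ v, ‖fderiv ℝ g v‖ ≤ C / (1 + ‖v‖)) (v w : V) :
    ‖g (v - w) - g v‖ ≤ C * (3 + 2 * Real.log (1 + ‖w‖)) := by
  have hC0 : 0 ≤ C := by simpa using (norm_nonneg _).trans (hC 0)
  have hlogw : 0 ≤ Real.log (1 + ‖w‖) := Real.log_nonneg (by linarith [norm_nonneg w])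
  rcases le_or_gt (2 * ‖w‖) ‖v‖ with hsmall | hlarge
  · exact (norm_map_sub_sub_map_le_of_two_mul_norm_le hg hC hsmall).trans
      (le_mul_of_one_le_right hC0 (by linarith))
  have hlog : ∀ y : V, ‖y‖ ≤ 3 * ‖w‖ → Real.log (1 + ‖y‖) ≤ 3 / 2 + Real.log (1 + ‖w‖) := by
    intro y hy
    have h3 : Real.log 3 ≤ 3 / 2 := by
      rw [Real.log_le_iff_le_exp (by norm_num)]
      have := Real.quadratic_le_exp_of_nonneg (show (0 : ℝ) ≤ 3 / 2 by norm_num)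
      linarith
    calc Real.log (1 + ‖y‖) ≤ Real.log (3 * (1 + ‖w‖)) :=
          Real.log_le_log (by positivity) (by linarith)
      _ = Real.log 3 + Real.log (1 + ‖w‖) := Real.log_mul (by norm_num) (by positivity)
      _ ≤ _ := by linarith
  have h1 := norm_sub_map_zero_le_log hg hC (v - w)
  have h2 := norm_sub_map_zero_le_log hg hC v
  have h3 := hlog (v - w) (by linarith [norm_sub_le v w])
  have h4 := hlog v (by linarith [norm_nonneg w])
  calc ‖g (v - w) - g v‖ = ‖(g (v - w) - g 0) - (g v - g 0)‖ := by rw [sub_sub_sub_cancel_right]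
    _ ≤ C * Real.log (1 + ‖v - w‖) + C * Real.log (1 + ‖v‖) :=
      (norm_sub_le _ _).trans (add_le_add h1 h2)
    _ ≤ C * (3 + 2 * Real.log (1 + ‖w‖)) := by nlinarith

theorem isModerateWeight_of_norm_fderiv_le {m : V → ℝ} {C : ℝ} (hpos : ∀ v, 0 < m v)
    (hm : Differentiable ℝ m) (hC : ∀ v, ‖fderiv ℝ m v‖ ≤ C * (m v / (1 + ‖v‖))) :
    IsModerateWeight m := by
  have hlog : ∀ v, ‖fderiv ℝ (fun v => Real.log (m v)) v‖ ≤ C / (1 + ‖v‖) := fun v => by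
    rw [fderiv.log (hm v) (hpos v).ne', norm_smul, norm_inv, Real.norm_of_nonneg (hpos v).le,
      inv_mul_le_iff₀ (hpos v)]
    exact (hC v).trans_eq (by ring)
  refine ⟨hpos, Real.exp (3 * C), ⌈2 * C⌉₊, fun v w => ?_⟩
  have h := (le_abs_self _).trans
    (norm_map_sub_sub_map_le_log (fun v => (hm v).log (hpos v).ne') hlog v w)
  have hceil : 2 * C * Real.log (1 + ‖w‖) ≤ ⌈2 * C⌉₊ * Real.log (1 + ‖w‖) :=
    mul_le_mul_of_nonneg_right (Nat.le_ceil _) (Real.log_nonneg (by linarith [norm_nonneg w]))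
  rw [← Real.log_le_log_iff (hpos _) (mul_pos (by positivity) (hpos v)),
    Real.log_mul (by positivity) (hpos v).ne', Real.log_mul (by positivity) (by positivity),
    Real.log_exp, Real.log_pow]
  linarith

end ModerateWeight

section Transport

variable {V : Type*} [NormedAddCommGroup V] [NormedSpace ℝ V]

/-- The point `v - t E`, where a particle with velocity `v` accelerated by the constant field `E`
was at time `-t`, as a linear function of `p = (E, v)`. -/
noncomputable def backtrack (t : ℝ) : V × V →L[ℝ] V :=
  ContinuousLinearMap.snd ℝ V V - t • ContinuousLinearMap.fst ℝ V V

theorem backtrack_apply (t : ℝ) (p : V × V) : backtrack t p = p.2 - t • p.1 := rfl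

theorem norm_backtrack_le {t : ℝ} (ht : 0 ≤ t) : ‖backtrack (V := V) t‖ ≤ 1 + t :=
  ContinuousLinearMap.opNorm_le_bound _ (by positivity) fun p => by
    have h2 : ‖t • p.1‖ ≤ t * ‖p‖ := by
      rw [norm_smul, Real.norm_of_nonneg ht]
      exact mul_le_mul_of_nonneg_left (norm_fst_le p) ht
    rw [backtrack_apply]
    linarith [norm_sub_le p.2 (t • p.1), norm_snd_le p]

theorem continuous_backtrack : Continuous fun q : (V × V) × ℝ => backtrack q.2 q.1 := by
  simp only [backtrack_apply]
  fun_prop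

/-- The accumulated absorption `∫₀ᵗ ν(v - sE) ds` along the trajectory, at `p = (E, v)`. -/
noncomputable def opticalDepth (ν : V → ℝ) (p : V × V) (t : ℝ) : ℝ :=
  ∫ s in 0..t, ν (backtrack s p)

/-- The contribution `exp (-∫₀ᵗ ν(v - sE) ds) h(v - tE)` of the source `h` at time `-t`, at
`p = (E, v)`. -/
noncomputable def attenuated (ν h : V → ℝ) (p : V × V) (t : ℝ) : ℝ :=
  Real.exp (-opticalDepth ν p t) * h (backtrack t p)

/-- The solution `f` of the stationary transport equation `E · ∇f + ν f = h`, given by Duhamel's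
formula along the trajectories. -/
noncomputable def transportResolvent (ν : V → ℝ) (E : V) (h : V → ℝ) (v : V) : ℝ :=
  ∫ t in Set.Ioi 0, attenuated ν h (E, v) t

/-- The assumptions on an absorption coefficient: `C¹`, bounded between two positive constants,
with a gradient of order `1 / ‖v‖` at infinity. -/
structure IsAbsorptionRate (ν : V → ℝ) : Prop where
  contDiff : ContDiff ℝ 1 ν
  bounds : ∃ ν₁ ν₂ : ℝ, 0 < ν₁ ∧ ∀ v, ν₁ ≤ ν v ∧ ν v ≤ ν₂
  fderiv_bound : ∃ B : ℝ, ∀ v, ‖fderiv ℝ ν v‖ ≤ B / (1 + ‖v‖)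

section OpticalDepth

variable {ν : V → ℝ}

theorem opticalDepth_zero (p : V × V) : opticalDepth ν p 0 = 0 :=
  intervalIntegral.integral_same

theorem continuous_comp_backtrack {h : V → ℝ} (hh : Continuous h) (p : V × V) :
    Continuous fun t => h (backtrack t p) :=
  hh.comp (continuous_backtrack.comp (Continuous.prodMk_right p))

theorem hasDerivAt_opticalDepth (hν : Continuous ν) (p : V × V) (t : ℝ) :
    HasDerivAt (opticalDepth ν p) (ν (backtrack t p)) t :=
  intervalIntegral.integral_hasDerivAt_right
    ((continuous_comp_backtrack hν p).intervalIntegrable 0 t)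
    (continuous_comp_backtrack hν p).stronglyMeasurable.stronglyMeasurableAtFilter
    (continuous_comp_backtrack hν p).continuousAt

theorem mul_le_opticalDepth (hν : Continuous ν) {a : ℝ} (ha : ∀ v, a ≤ ν v) (p : V × V) {t : ℝ}
    (ht : 0 ≤ t) : a * t ≤ opticalDepth ν p t := by
  have h := intervalIntegral.integral_mono_on ht (intervalIntegrable_const (μ := volume) (c := a))
    ((continuous_comp_backtrack hν p).intervalIntegrable 0 t) fun s _ => ha _
  simpa [opticalDepth, mul_comm] using h

theorem opticalDepth_le_mul (hν : Continuous ν) {b : ℝ} (hb : ∀ v, ν v ≤ b) (p : V × V) {t : ℝ}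
    (ht : 0 ≤ t) : opticalDepth ν p t ≤ b * t := by
  have h := intervalIntegral.integral_mono_on ht
    ((continuous_comp_backtrack hν p).intervalIntegrable 0 t)
    (intervalIntegrable_const (μ := volume) (c := b)) fun s _ => hb _
  simpa [opticalDepth, mul_comm] using h

theorem continuous_opticalDepth (hν : Continuous ν) :
    Continuous fun q : (V × V) × ℝ => opticalDepth ν q.1 q.2 :=
  intervalIntegral.continuous_parametric_intervalIntegral_of_continuous
    (f := fun (q : (V × V) × ℝ) s => ν (backtrack s q.1))
    (hν.comp (continuous_backtrack.comp
      ((continuous_fst.comp continuous_fst).prodMk continuous_snd))) continuous_snd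

theorem backtrack_add_smul (E v : V) (r t : ℝ) :
    backtrack t (E, v + r • E) = backtrack (t - r) (E, v) := by
  simp only [backtrack_apply, sub_smul]
  abel

theorem opticalDepth_add_smul (hν : Continuous ν) (E v : V) (r t : ℝ) :
    opticalDepth ν (E, v + r • E) t =
      opticalDepth ν (E, v) (t - r) - opticalDepth ν (E, v) (-r) := by
  have hint := (continuous_comp_backtrack hν (E, v)).intervalIntegrable (μ := volume)
  simp only [opticalDepth, backtrack_add_smul]
  rw [intervalIntegral.integral_interval_sub_left (hint _ _) (hint _ _),
    intervalIntegral.integral_comp_sub_right fun s => ν (backtrack s (E, v)), zero_sub]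

theorem one_add_norm_mul_le {E : V} {R t : ℝ} (hE : ‖E‖ ≤ R) (ht : 0 ≤ t) :
    1 + ‖t • E‖ ≤ (1 + R) * (1 + t) := by
  rw [norm_smul, Real.norm_of_nonneg ht]
  nlinarith [norm_nonneg E]

theorem norm_fderiv_comp_backtrack_le {h : V → ℝ} (hh : Differentiable ℝ h) {B : ℝ} {w : V → ℝ}
    (hB : ∀ v, ‖fderiv ℝ h v‖ ≤ B * w v) (p : V × V) {t : ℝ} (ht : 0 ≤ t) :
    ‖fderiv ℝ (fun p => h (backtrack t p)) p‖ ≤ B * w (backtrack t p) * (1 + t) := by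
  have hder := (hh (backtrack t p)).hasFDerivAt.comp p
    (backtrack (V := V) t).hasFDerivAt
  rw [show (fun p => h (backtrack t p)) = h ∘ backtrack t from rfl, hder.fderiv]
  exact (ContinuousLinearMap.opNorm_comp_le _ _).trans
    (mul_le_mul (hB _) (norm_backtrack_le ht) (norm_nonneg _) ((norm_nonneg _).trans (hB _)))

end OpticalDepth

namespace IsAbsorptionRate

variable {ν : V → ℝ} (hν : IsAbsorptionRate ν)
include hν

theorem continuous : Continuous ν := hν.contDiff.continuous

theorem exists_norm_fderiv_comp_backtrack_le :
    ∃ B, 0 ≤ B ∧ ∀ (p : V × V) s, 0 ≤ s → ‖fderiv ℝ (fun p => ν (backtrack s p)) p‖ ≤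
      B * (1 + s) * min 1 ((1 + ‖s • p.1‖) / (1 + ‖p.2‖)) := by
  obtain ⟨B, hB⟩ := hν.fderiv_bound
  have hB0 : 0 ≤ B := by simpa using (norm_nonneg _).trans (hB 0)
  refine ⟨B, hB0, fun p s hs => ?_⟩
  have h := norm_fderiv_comp_backtrack_le (hν.contDiff.differentiable one_ne_zero)
    (fun v => (hB v).trans_eq (div_eq_mul_inv _ _)) p hs
  refine h.trans ?_
  rw [mul_right_comm]
  gcongr
  exact le_min (inv_le_one_of_one_le₀ (by linarith [norm_nonneg (backtrack s p)]))
    (inv_one_add_norm_sub_le p.2 (s • p.1))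

variable [FiniteDimensional ℝ V]

theorem contDiff_opticalDepth {t : ℝ} (ht : 0 ≤ t) :
    ContDiff ℝ 1 (opticalDepth ν · t) ∧ ∀ p, fderiv ℝ (opticalDepth ν · t) p =
      ∫ s in Set.Ioc 0 t, fderiv ℝ (fun p => ν (backtrack s p)) p := by
  obtain ⟨ν₁, ν₂, hν₁, hbd⟩ := hν.bounds
  obtain ⟨B, hB0, hB⟩ := hν.exists_norm_fderiv_comp_backtrack_le
  simp only [opticalDepth, intervalIntegral.integral_of_le ht]
  refine contDiff_one_integral_of_continuous (hν.continuous.comp continuous_backtrack)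
    (Eventually.of_forall fun s => hν.contDiff.comp (backtrack (V := V) s).contDiff)
    fun _ => ⟨fun _ => ν₂ + B * (1 + t), integrable_const _, ?_⟩
  filter_upwards [self_mem_ae_restrict measurableSet_Ioc] with s hs p _
  have hν₂ : 0 ≤ ν₂ := hν₁.le.trans ((hbd 0).1.trans (hbd 0).2)
  have hs₀ := hs.1
  refine ⟨?_, (hB p s hs₀.le).trans ?_⟩
  · rw [abs_of_pos (hν₁.trans_le (hbd _).1)]
    nlinarith [(hbd (backtrack s p)).2]
  · calc B * (1 + s) * min 1 ((1 + ‖s • p.1‖) / (1 + ‖p.2‖)) ≤ B * (1 + t) * 1 := by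
          gcongr
          exacts [hs.2, min_le_left _ _]
      _ ≤ ν₂ + B * (1 + t) := by linarith

theorem exists_norm_fderiv_opticalDepth_le :
    ∃ B, 0 ≤ B ∧ ∀ t, 0 ≤ t → ∀ R (p : V × V), ‖p.1‖ ≤ R →
      ‖fderiv ℝ (opticalDepth ν · t) p‖ ≤ B * ((1 + R) * (1 + t) ^ 3) / (1 + ‖p.2‖) := by
  obtain ⟨B, hB0, hB⟩ := hν.exists_norm_fderiv_comp_backtrack_le
  refine ⟨B, hB0, fun t ht R p hp => ?_⟩
  have hR : 0 ≤ R := (norm_nonneg _).trans hp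
  have hle : ∀ s ∈ Set.Ioc 0 t, ‖fderiv ℝ (fun p => ν (backtrack s p)) p‖ ≤
      B * (1 + t) * ((1 + R) * (1 + t) / (1 + ‖p.2‖)) := fun s hs => by
    refine (hB p s hs.1.le).trans ?_
    have hmul : 1 + ‖s • p.1‖ ≤ (1 + R) * (1 + t) :=
      (one_add_norm_mul_le hp hs.1.le).trans (by gcongr; exact hs.2)
    have hs' := hs.2
    gcongr
    exact (min_le_right _ _).trans (by gcongr)
  rw [(hν.contDiff_opticalDepth ht).2 p]
  have h := norm_setIntegral_le_of_norm_le_const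
    (measure_Ioc_lt_top (μ := (volume : Measure ℝ))) hle
  rw [Real.volume_real_Ioc_of_le ht, sub_zero] at h
  calc _ ≤ B * (1 + t) * ((1 + R) * (1 + t) / (1 + ‖p.2‖)) * t := h
    _ ≤ B * (1 + t) * ((1 + R) * (1 + t) / (1 + ‖p.2‖)) * (1 + t) := by gcongr; linarith
    _ = _ := by ring

theorem contDiff_attenuated {h : V → ℝ} (hh : ContDiff ℝ 1 h) {t : ℝ} (ht : 0 ≤ t) :
    ContDiff ℝ 1 (attenuated ν h · t) :=
  (hν.contDiff_opticalDepth ht).1.neg.exp.mul (hh.comp (backtrack (V := V) t).contDiff)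

end IsAbsorptionRate

end Transport

section Attenuation

variable {V : Type*} [NormedAddCommGroup V] [NormedSpace ℝ V]

/-- A source `h` for the transport equation: `C¹`, of size `a m` with a gradient of size
`a m / (1 + ‖v‖)`. -/
structure IsTransportSource (m : V → ℝ) (a : ℝ) (h : V → ℝ) : Prop where
  contDiff : ContDiff ℝ 1 h
  abs_le : ∀ v, |h v| ≤ a * m v
  norm_fderiv_le : ∀ v, ‖fderiv ℝ h v‖ ≤ a * (m v / (1 + ‖v‖))

theorem abs_attenuated (ν h : V → ℝ) (p : V × V) (t : ℝ) :
    |attenuated ν h p t| = Real.exp (-opticalDepth ν p t) * |h (backtrack t p)| := by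
  rw [attenuated, abs_mul, Real.abs_exp]

theorem attenuated_zero (ν h : V → ℝ) (p : V × V) : attenuated ν h p 0 = h p.2 := by
  simp [attenuated, opticalDepth_zero, backtrack_apply]

theorem attenuated_add_smul {ν : V → ℝ} (hν : Continuous ν) (h : V → ℝ) (E v : V) (r t : ℝ) :
    attenuated ν h (E, v + r • E) t =
      Real.exp (opticalDepth ν (E, v) (-r)) * attenuated ν h (E, v) (t - r) := by
  rw [attenuated, attenuated, opticalDepth_add_smul hν, backtrack_add_smul, ← mul_assoc,
    ← Real.exp_add]
  ring_nf

theorem continuous_attenuated {ν : V → ℝ} (hν : Continuous ν) {Y : Type*} [TopologicalSpace Y]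
    {h : Y → V → ℝ} (hh : Continuous h.uncurry) :
    Continuous fun q : ((V × V) × Y) × ℝ => attenuated ν (h q.1.2) q.1.1 q.2 :=
  (continuous_opticalDepth hν).comp ((continuous_fst.comp continuous_fst).prodMk continuous_snd)
    |>.neg.rexp.mul (hh.comp ((continuous_snd.comp continuous_fst).prodMk
      (continuous_backtrack.comp ((continuous_fst.comp continuous_fst).prodMk continuous_snd))))

theorem continuous_attenuated_apply {ν : V → ℝ} (hν : Continuous ν) {h : V → ℝ}
    (hh : Continuous h) : Continuous (attenuated ν h).uncurry :=
  (continuous_attenuated hν (Y := Unit) (h := fun _ => h) (hh.comp continuous_snd)).comp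
    ((continuous_fst.prodMk (continuous_const (y := ()))).prodMk continuous_snd)

theorem transportResolvent_add_smul {ν : V → ℝ} (hν : Continuous ν) {h : V → ℝ}
    (hh : Continuous h) {E v : V} (hint : IntegrableOn (attenuated ν h (E, v)) (Set.Ioi 0))
    (r : ℝ) :
    transportResolvent ν E h (v + r • E) = Real.exp (opticalDepth ν (E, v) (-r)) *
      ((∫ t in -r..0, attenuated ν h (E, v) t) + transportResolvent ν E h v) := by
  have hcont : Continuous (attenuated ν h (E, v)) :=
    (continuous_attenuated_apply hν hh).comp (Continuous.prodMk_right _)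
  have hshift : ∫ t in Set.Ioi 0, attenuated ν h (E, v) (t - r) =
      ∫ t in Set.Ioi (-r), attenuated ν h (E, v) t := by
    have h := (measurePreserving_sub_right volume r).setIntegral_preimage_emb
      (Homeomorph.subRight r).measurableEmbedding (attenuated ν h (E, v)) (Set.Ioi (-r))
    simpa using h
  rw [transportResolvent, transportResolvent,
    intervalIntegral.integral_interval_add_Ioi' (hcont.intervalIntegrable _ _) hint, ← hshift,
    ← integral_const_mul]
  simp only [attenuated_add_smul hν]

theorem hasLineDerivAt_transportResolvent {ν : V → ℝ} (hν : Continuous ν) {h : V → ℝ}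
    (hh : Continuous h) {E v : V} (hint : IntegrableOn (attenuated ν h (E, v)) (Set.Ioi 0)) :
    HasLineDerivAt ℝ (transportResolvent ν E h) (h v - ν v * transportResolvent ν E h v) v E := by
  have hcont : Continuous (attenuated ν h (E, v)) :=
    (continuous_attenuated_apply hν hh).comp (Continuous.prodMk_right _)
  have hexp : HasDerivAt (fun r => Real.exp (opticalDepth ν (E, v) (-r))) (-ν v) 0 := by
    have hdepth := hasDerivAt_opticalDepth hν (E, v) (-0)
    rw [neg_zero, ← neg_zero] at hdepth
    have := (hdepth.comp 0 (hasDerivAt_neg 0)).exp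
    simpa [opticalDepth_zero, backtrack_apply] using this
  have hmass : HasDerivAt (fun r => (∫ t in -r..0, attenuated ν h (E, v) t) +
      transportResolvent ν E h v) (h v) 0 := by
    have hprim : HasDerivAt (fun a => ∫ t in a..0, attenuated ν h (E, v) t)
        (-attenuated ν h (E, v) (-0)) (-0) :=
      intervalIntegral.integral_hasDerivAt_left (hcont.intervalIntegrable _ _)
        hcont.stronglyMeasurable.stronglyMeasurableAtFilter hcont.continuousAt
    have := (hprim.comp 0 (hasDerivAt_neg 0)).add_const (transportResolvent ν E h v)
    simpa [attenuated_zero] using this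
  unfold HasLineDerivAt
  simp only [transportResolvent_add_smul hν hh hint]
  refine (hexp.mul hmass).congr_deriv ?_
  simp only [neg_zero, opticalDepth_zero, Real.exp_zero, intervalIntegral.integral_same]
  ring

theorem norm_fderiv_attenuated_le {ν h : V → ℝ} {p : V × V} {t : ℝ}
    (hν : DifferentiableAt ℝ (opticalDepth ν · t) p) (hh : DifferentiableAt ℝ h (backtrack t p)) :
    ‖fderiv ℝ (attenuated ν h · t) p‖ ≤
      Real.exp (-opticalDepth ν p t) * ‖fderiv ℝ (fun p => h (backtrack t p)) p‖ +
        |h (backtrack t p)| * (Real.exp (-opticalDepth ν p t) *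
          ‖fderiv ℝ (opticalDepth ν · t) p‖) := by
  have hsource : DifferentiableAt ℝ (fun p => h (backtrack t p)) p :=
    hh.comp p (backtrack (V := V) t).differentiableAt
  have hder : HasFDerivAt (attenuated ν h · t) _ p :=
    hν.hasFDerivAt.neg.exp.mul hsource.hasFDerivAt
  rw [hder.fderiv]
  refine (norm_add_le _ _).trans_eq ?_
  rw [norm_smul, norm_smul, norm_smul, norm_neg, Real.norm_eq_abs, Real.abs_exp, Real.norm_eq_abs]
  rfl

namespace IsAbsorptionRate

variable {ν m : V → ℝ} (hν : IsAbsorptionRate ν) (hm : IsModerateWeight m)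
include hν hm

theorem exists_exp_neg_opticalDepth_mul_le (R : ℝ) (j : ℕ) :
    ∃ b : ℝ → ℝ, IntegrableOn b (Set.Ioi 0) ∧ (∀ t, 0 ≤ t → 0 ≤ b t) ∧
      ∀ (p : V × V) t, ‖p.1‖ ≤ R → 0 ≤ t →
        Real.exp (-opticalDepth ν p t) * (1 + t) ^ j * m (backtrack t p) ≤ b t * m p.2 := by
  obtain ⟨ν₁, ν₂, hν₁, hbd⟩ := hν.bounds
  obtain ⟨A, k, hA0, hA⟩ := hm.exists_pos_sub_le
  refine ⟨fun t => A * (1 + |R|) ^ k * (Real.exp (-(ν₁ * t)) * (1 + t) ^ (j + k)),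
    (integrableOn_exp_neg_mul_one_add_pow hν₁ _).const_mul _, fun t ht => by positivity,
    fun p t hp ht => ?_⟩
  have hexp : Real.exp (-opticalDepth ν p t) ≤ Real.exp (-(ν₁ * t)) :=
    Real.exp_le_exp.2 (neg_le_neg (mul_le_opticalDepth hν.continuous (fun v => (hbd v).1) p ht))
  have hmv : m (backtrack t p) ≤ A * ((1 + |R|) * (1 + t)) ^ k * m p.2 :=
    (hA p.2 (t • p.1)).trans (by
      have := (hm.pos p.2).le
      gcongr
      exact one_add_norm_mul_le (hp.trans (le_abs_self R)) ht)
  calc _ ≤ Real.exp (-(ν₁ * t)) * (1 + t) ^ j * (A * ((1 + |R|) * (1 + t)) ^ k * m p.2) :=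
        mul_le_mul (by gcongr) hmv (hm.pos _).le (by positivity)
    _ = _ := by rw [mul_pow]; ring

theorem exists_abs_attenuated_le (R : ℝ) :
    ∃ b : ℝ → ℝ, IntegrableOn b (Set.Ioi 0) ∧ ∀ a h, (∀ v, |h v| ≤ a * m v) →
      ∀ (p : V × V) t, ‖p.1‖ ≤ R → 0 ≤ t → |attenuated ν h p t| ≤ a * b t * m p.2 := by
  obtain ⟨b, hbi, -, hb⟩ := hν.exists_exp_neg_opticalDepth_mul_le hm R 0
  refine ⟨b, hbi, fun a h hh p t hp ht => ?_⟩
  have ha : 0 ≤ a := nonneg_of_mul_nonneg_left ((abs_nonneg _).trans (hh 0)) (hm.pos 0)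
  have hbp := hb p t hp ht
  rw [pow_zero, mul_one] at hbp
  calc |attenuated ν h p t| ≤ Real.exp (-opticalDepth ν p t) * (a * m (backtrack t p)) := by
        rw [abs_attenuated]
        gcongr
        exact hh _
    _ = a * (Real.exp (-opticalDepth ν p t) * m (backtrack t p)) := by ring
    _ ≤ a * (b t * m p.2) := by gcongr
    _ = _ := by ring

theorem integrableOn_attenuated {h : V → ℝ} (hh : Continuous h) {a : ℝ}
    (ha : ∀ v, |h v| ≤ a * m v) (p : V × V) :
    IntegrableOn (attenuated ν h p) (Set.Ioi 0) := by
  obtain ⟨b, hbi, hb⟩ := hν.exists_abs_attenuated_le hm ‖p.1‖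
  refine ((hbi.const_mul a).mul_const (m p.2)).mono' ?_ ?_
  · exact ((continuous_attenuated_apply hν.continuous hh).comp
      (Continuous.prodMk_right p)).aestronglyMeasurable
  · filter_upwards [self_mem_ae_restrict measurableSet_Ioi] with t ht
    exact hb a h ha p t le_rfl ht.le

theorem exists_abs_transportResolvent_le (R : ℝ) :
    ∃ C, ∀ a h, (∀ v, |h v| ≤ a * m v) → ∀ E, ‖E‖ ≤ R → ∀ v,
      |transportResolvent ν E h v| ≤ a * C * m v := by
  obtain ⟨b, hbi, hb⟩ := hν.exists_abs_attenuated_le hm R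
  refine ⟨∫ t in Set.Ioi 0, b t, fun a h hh E hE v => ?_⟩
  refine (norm_integral_le_of_norm_le (f := attenuated ν h (E, v))
    ((hbi.const_mul a).mul_const (m v)) ?_).trans_eq
    (by rw [integral_mul_const, integral_const_mul])
  filter_upwards [self_mem_ae_restrict measurableSet_Ioi] with t ht
  exact hb a h hh (E, v) t hE ht.le

theorem exists_le_attenuated (R : ℝ) :
    ∃ c, 0 < c ∧ ∀ E, ‖E‖ ≤ R → ∀ v, ∀ t ∈ Set.Ioc (0 : ℝ) 1,
      c * m v ≤ attenuated ν m (E, v) t := by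
  obtain ⟨ν₁, ν₂, hν₁, hbd⟩ := hν.bounds
  obtain ⟨A, k, hA0, hA⟩ := hm.exists_pos_sub_le
  have hν₂ : 0 ≤ ν₂ := hν₁.le.trans ((hbd 0).1.trans (hbd 0).2)
  refine ⟨Real.exp (-ν₂) * (A * (1 + |R|) ^ k)⁻¹, by positivity, fun E hE v t ht => ?_⟩
  have hdepth : opticalDepth ν (E, v) t ≤ ν₂ :=
    (opticalDepth_le_mul hν.continuous (fun v => (hbd v).2) (E, v) ht.1.le).trans
      (mul_le_of_le_one_right hν₂ ht.2)
  have hE' : ‖-(t • E)‖ ≤ |R| := by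
    rw [norm_neg, norm_smul, Real.norm_of_nonneg ht.1.le]
    exact (mul_le_of_le_one_left (norm_nonneg E) ht.2).trans (hE.trans (le_abs_self R))
  have hmv : (A * (1 + |R|) ^ k)⁻¹ * m v ≤ m (backtrack t (E, v)) := by
    rw [inv_mul_le_iff₀ (by positivity)]
    have h := hA (backtrack t (E, v)) (-(t • E))
    rw [backtrack_apply, sub_neg_eq_add, sub_add_cancel] at h
    have := (hm.pos (v - t • E)).le
    exact h.trans (by rw [backtrack_apply]; gcongr)
  rw [mul_assoc, attenuated]
  have := (hm.pos v).le
  gcongr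

theorem exists_le_transportResolvent (hc : Continuous m) (R : ℝ) :
    ∃ c, 0 < c ∧ ∀ E, ‖E‖ ≤ R → ∀ v, c * m v ≤ transportResolvent ν E m v := by
  obtain ⟨c, hc₀, hcR⟩ := hν.exists_le_attenuated hm R
  refine ⟨c, hc₀, fun E hE v => ?_⟩
  have hint := hν.integrableOn_attenuated hm hc (a := 1)
    (fun v => by rw [abs_of_pos (hm.pos v), one_mul]) (E, v)
  calc c * m v = ∫ _ in Set.Ioc (0 : ℝ) 1, c * m v := by simp
    _ ≤ ∫ t in Set.Ioc (0 : ℝ) 1, attenuated ν m (E, v) t :=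
      setIntegral_mono_on (integrable_const _) (hint.mono_set Set.Ioc_subset_Ioi_self)
        measurableSet_Ioc (hcR E hE v)
    _ ≤ transportResolvent ν E m v := setIntegral_mono_set hint
      (Eventually.of_forall fun t => mul_nonneg (Real.exp_nonneg _) (hm.pos _).le)
      Set.Ioc_subset_Ioi_self.eventuallyLE

theorem continuous_transportResolvent {Y : Type*} [TopologicalSpace Y] [FirstCountableTopology Y]
    {h : Y → V → ℝ} (hh : Continuous h.uncurry) {a : ℝ} (ha : ∀ y v, |h y v| ≤ a * m v) :
    Continuous fun q : (V × V) × Y => transportResolvent ν q.1.1 (h q.2) q.1.2 := by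
  have ha0 : 0 ≤ a ∨ IsEmpty Y := by
    rcases isEmpty_or_nonempty Y with hY | ⟨⟨y⟩⟩
    · exact .inr hY
    · exact .inl (nonneg_of_mul_nonneg_left ((abs_nonneg _).trans (ha y 0)) (hm.pos 0))
  rcases ha0 with ha0 | hY
  swap
  · exact continuous_of_const fun q => hY.elim q.2
  refine continuous_iff_continuousAt.2 fun q => ?_
  obtain ⟨b, hbi, hb⟩ := hν.exists_abs_attenuated_le hm (‖q.1‖ + 1)
  obtain ⟨B, -, hB⟩ := hm.exists_le_of_norm_le (‖q.1‖ + 1)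
  have hcont := continuous_attenuated hν.continuous hh
  refine continuousAt_of_dominated (bound := fun t => a * |b t| * B)
    (Eventually.of_forall fun q' =>
      (hcont.comp (Continuous.prodMk_right q')).aestronglyMeasurable) ?_
    ((hbi.abs.const_mul a).mul_const B)
    (Eventually.of_forall fun t => (hcont.comp (Continuous.prodMk_left t)).continuousAt)
  have hnear : ∀ᶠ q' in 𝓝 q, ‖q'.1‖ ≤ ‖q.1‖ + 1 :=
    (continuous_fst.norm.tendsto q).eventually_le_const (lt_add_one _)
  filter_upwards [hnear] with q' hq'
  filter_upwards [self_mem_ae_restrict measurableSet_Ioi] with t ht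
  refine (hb a _ (ha q'.2) q'.1 t ((norm_fst_le _).trans hq') ht.le).trans ?_
  have := (hm.pos q'.1.2).le
  have := hB q'.1.2 ((norm_snd_le _).trans hq')
  gcongr
  exact le_abs_self _

theorem exists_norm_fderiv_attenuated_le [FiniteDimensional ℝ V] (R : ℝ) :
    ∃ b : ℝ → ℝ, IntegrableOn b (Set.Ioi 0) ∧ (∀ t, 0 ≤ t → 0 ≤ b t) ∧
      ∀ a h, IsTransportSource m a h → ∀ t, 0 ≤ t → ∀ p : V × V, ‖p.1‖ ≤ R →
        ‖fderiv ℝ (attenuated ν h · t) p‖ ≤ a * b t * (m p.2 / (1 + ‖p.2‖)) := by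
  obtain ⟨B, hB0, hB⟩ := hν.exists_norm_fderiv_opticalDepth_le
  obtain ⟨b₁, hb₁i, hb₁0, hb₁⟩ :=
    hν.exists_exp_neg_opticalDepth_mul_le hm.div_one_add_norm R 1
  obtain ⟨b₂, hb₂i, hb₂0, hb₂⟩ := hν.exists_exp_neg_opticalDepth_mul_le hm R 3
  refine ⟨fun t => b₁ t + B * (1 + |R|) * b₂ t, hb₁i.add (hb₂i.const_mul _), fun t ht => ?_,
    fun a h hh t ht p hp => ?_⟩
  · have := hb₁0 t ht
    have := hb₂0 t ht
    positivity
  have ha : 0 ≤ a := nonneg_of_mul_nonneg_left ((abs_nonneg _).trans (hh.abs_le 0)) (hm.pos 0)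
  have h₁ := norm_fderiv_comp_backtrack_le (hh.contDiff.differentiable one_ne_zero)
    hh.norm_fderiv_le p ht
  have h₂ := hB t ht |R| p (hp.trans (le_abs_self R))
  have hpos := (hm.pos (backtrack t p)).le
  calc _ ≤ _ := norm_fderiv_attenuated_le
        ((hν.contDiff_opticalDepth ht).1.differentiable one_ne_zero p)
        (hh.contDiff.differentiable one_ne_zero _)
    _ ≤ Real.exp (-opticalDepth ν p t) *
          (a * (m (backtrack t p) / (1 + ‖backtrack t p‖)) * (1 + t)) +
        a * m (backtrack t p) * (Real.exp (-opticalDepth ν p t) *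
          (B * ((1 + |R|) * (1 + t) ^ 3) / (1 + ‖p.2‖))) := by
        gcongr
        exact hh.abs_le _
    _ = a * (Real.exp (-opticalDepth ν p t) * (1 + t) ^ 1 *
          (m (backtrack t p) / (1 + ‖backtrack t p‖))) +
        a * (B * (1 + |R|)) * (Real.exp (-opticalDepth ν p t) * (1 + t) ^ 3 *
          m (backtrack t p)) / (1 + ‖p.2‖) := by ring
    _ ≤ a * (b₁ t * (m p.2 / (1 + ‖p.2‖))) +
        a * (B * (1 + |R|)) * (b₂ t * m p.2) / (1 + ‖p.2‖) := by
        gcongr a * ?_ + _ * ?_ / _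
        · exact hb₁ p t hp ht
        · exact hb₂ p t hp ht
    _ = _ := by ring

theorem contDiff_transportResolvent [FiniteDimensional ℝ V] {a : ℝ} {h : V → ℝ}
    (hh : IsTransportSource m a h) :
    ContDiff ℝ 1 (fun p : V × V => transportResolvent ν p.1 h p.2) ∧
      ∀ p : V × V, fderiv ℝ (fun p : V × V => transportResolvent ν p.1 h p.2) p =
        ∫ t in Set.Ioi 0, fderiv ℝ (attenuated ν h · t) p := by
  refine contDiff_one_integral_of_continuous
    (continuous_attenuated_apply hν.continuous hh.contDiff.continuous) ?_ fun R => ?_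
  · filter_upwards [self_mem_ae_restrict measurableSet_Ioi] with t ht
    exact hν.contDiff_attenuated hh.contDiff ht.le
  · have ha : 0 ≤ a := nonneg_of_mul_nonneg_left ((abs_nonneg _).trans (hh.abs_le 0)) (hm.pos 0)
    obtain ⟨b, hbi, hb⟩ := hν.exists_abs_attenuated_le hm R
    obtain ⟨b', hb'i, hb'0, hb'⟩ := hν.exists_norm_fderiv_attenuated_le hm R
    obtain ⟨B, hB0, hB⟩ := hm.exists_le_of_norm_le R
    refine ⟨fun t => a * |b t| * B + a * b' t * B,
      ((hbi.abs.const_mul a).mul_const B).add ((hb'i.const_mul a).mul_const B), ?_⟩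
    filter_upwards [self_mem_ae_restrict measurableSet_Ioi] with t ht p hp
    have hfst := (norm_fst_le p).trans hp
    have hmB := hB p.2 ((norm_snd_le p).trans hp)
    have hm0 := (hm.pos p.2).le
    have hb't := hb'0 t ht.le
    have hdiv : m p.2 / (1 + ‖p.2‖) ≤ B :=
      (div_le_self hm0 (by linarith [norm_nonneg p.2])).trans hmB
    constructor
    · refine (hb a h hh.abs_le p t hfst ht.le).trans ?_
      calc a * b t * m p.2 ≤ a * |b t| * B := by gcongr; exact le_abs_self _
        _ ≤ _ := by linarith [show 0 ≤ a * b' t * B by positivity]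
    · refine (hb' a h hh t ht.le p hfst).trans ?_
      calc _ ≤ a * b' t * B := by gcongr
        _ ≤ _ := by linarith [show 0 ≤ a * |b t| * B by positivity]

theorem exists_norm_fderiv_transportResolvent_le [FiniteDimensional ℝ V] (R : ℝ) :
    ∃ C, ∀ a h, IsTransportSource m a h → ∀ p : V × V, ‖p.1‖ ≤ R →
      ‖fderiv ℝ (fun p : V × V => transportResolvent ν p.1 h p.2) p‖ ≤
        a * C * (m p.2 / (1 + ‖p.2‖)) := by
  obtain ⟨b, hbi, -, hb⟩ := hν.exists_norm_fderiv_attenuated_le hm R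
  refine ⟨∫ t in Set.Ioi 0, b t, fun a h hh p hp => ?_⟩
  rw [(hν.contDiff_transportResolvent hm hh).2]
  refine (norm_integral_le_of_norm_le ((hbi.const_mul a).mul_const _) ?_).trans_eq
    (by rw [integral_mul_const, integral_const_mul])
  filter_upwards [self_mem_ae_restrict measurableSet_Ioi] with t ht
  exact hb a h hh t ht.le p hp

end IsAbsorptionRate

end Attenuation

section DominatedFamily

variable {P X Y : Type*} [NormedAddCommGroup P] [NormedSpace ℝ P]

/-- A family `f p` of functions depending in a `C¹` way on the parameter `p` and dominated,
together with its derivative in `p`, by the weight `w`, locally uniformly in `p`. -/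
structure IsDominatedFamily [TopologicalSpace X] (w : X → ℝ) (f : P → X → ℝ) : Prop where
  continuous : Continuous f.uncurry
  contDiff : ∀ x, ContDiff ℝ 1 (f · x)
  bound : ∀ R, ∃ B, ∀ p, ‖p‖ ≤ R → ∀ x, |f p x| ≤ B * w x ∧ ‖fderiv ℝ (f · x) p‖ ≤ B * w x

/-- The family of functions `∫ K p (x, y) f p y dμ(y)` of `x`, for a family of kernels `K p` and a
family of functions `f p`. -/
noncomputable def kernelIntegral [MeasurableSpace Y] (μ : Measure Y) (K : P → X × Y → ℝ)
    (f : P → Y → ℝ) (p : P) (x : X) : ℝ :=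
  ∫ y, K p (x, y) * f p y ∂μ

variable [TopologicalSpace X] [TopologicalSpace Y] {w : X → ℝ} {u : Y → ℝ}

namespace IsDominatedFamily

theorem continuous_apply {f : P → X → ℝ} (hf : IsDominatedFamily w f) (p : P) :
    Continuous (f p) :=
  hf.continuous.comp (Continuous.prodMk_right p)

theorem differentiableAt {f : P → X → ℝ} (hf : IsDominatedFamily w f) (x : X) (p : P) :
    DifferentiableAt ℝ (f · x) p :=
  (hf.contDiff x).differentiable one_ne_zero p

theorem norm_fderiv_mul_le {K : P → X × Y → ℝ} {f : P → Y → ℝ}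
    (hK : IsDominatedFamily (fun z : X × Y => w z.1) K) (hf : IsDominatedFamily u f) (p : P)
    (x : X) (y : Y) :
    ‖fderiv ℝ (fun p => K p (x, y) * f p y) p‖ ≤
      |K p (x, y)| * ‖fderiv ℝ (f · y) p‖ + ‖fderiv ℝ (K · (x, y)) p‖ * |f p y| := by
  rw [fderiv_fun_mul (hK.differentiableAt _ p) (hf.differentiableAt y p)]
  refine (norm_add_le _ _).trans_eq ?_
  rw [norm_smul, norm_smul, Real.norm_eq_abs, Real.norm_eq_abs, mul_comm |f p y|]

theorem exists_mul_le {K : P → X × Y → ℝ} {f : P → Y → ℝ}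
    (hK : IsDominatedFamily (fun z : X × Y => w z.1) K) (hf : IsDominatedFamily u f) (R : ℝ) :
    ∃ B, ∀ p, ‖p‖ ≤ R → ∀ x y, |K p (x, y) * f p y| ≤ B * w x * u y ∧
      ‖fderiv ℝ (fun p => K p (x, y) * f p y) p‖ ≤ B * w x * u y := by
  obtain ⟨B, hB⟩ := hK.bound R
  obtain ⟨B', hB'⟩ := hf.bound R
  refine ⟨2 * (B * B'), fun p hp x y => ?_⟩
  have hw : 0 ≤ B * w x := (abs_nonneg _).trans (hB p hp (x, y)).1
  have hu : 0 ≤ B' * u y := (abs_nonneg _).trans (hB' p hp y).1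
  have hmul : 2 * (B * B') * w x * u y = B * w x * (B' * u y) + B * w x * (B' * u y) := by ring
  rw [hmul]
  constructor
  · rw [abs_mul]
    have := mul_le_mul (hB p hp (x, y)).1 (hB' p hp y).1 (abs_nonneg _) hw
    linarith [mul_nonneg hw hu]
  · exact (hK.norm_fderiv_mul_le hf p x y).trans (add_le_add
      (mul_le_mul (hB p hp (x, y)).1 (hB' p hp y).2 (norm_nonneg _) hw)
      (mul_le_mul (hB p hp (x, y)).2 (hB' p hp y).1 (abs_nonneg _) hw))

theorem continuous_kernel_mul {K : P → X × Y → ℝ} {f : P → Y → ℝ}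
    (hK : IsDominatedFamily (fun z : X × Y => w z.1) K) (hf : IsDominatedFamily u f) (x : X) :
    Continuous (fun p y => K p (x, y) * f p y).uncurry :=
  (hK.continuous.comp (f := fun q : P × Y => (q.1, (x, q.2))) (by fun_prop)).mul hf.continuous

variable [MeasurableSpace Y] [OpensMeasurableSpace Y] {μ : Measure Y}

theorem integrable_kernel_mul {K : P → X × Y → ℝ} {f : P → Y → ℝ}
    (hK : IsDominatedFamily (fun z : X × Y => w z.1) K) (hf : IsDominatedFamily u f)
    (hu : Integrable u μ) (p : P) (x : X) : Integrable (fun y => K p (x, y) * f p y) μ := by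
  obtain ⟨B, hB⟩ := hK.exists_mul_le hf ‖p‖
  exact (hu.const_mul (B * w x)).mono'
    ((hK.continuous_kernel_mul hf x).comp (Continuous.prodMk_right p)).aestronglyMeasurable
    (Eventually.of_forall fun y => (hB p le_rfl x y).1)

theorem continuous_kernelIntegral [FirstCountableTopology X] (hw : Continuous w)
    {K : P → X × Y → ℝ} {f : P → Y → ℝ} (hK : IsDominatedFamily (fun z : X × Y => w z.1) K)
    (hf : IsDominatedFamily u f) (hu : Integrable u μ) :
    Continuous (kernelIntegral μ K f).uncurry := by
  have hcont : Continuous fun q : (P × X) × Y => K q.1.1 (q.1.2, q.2) * f q.1.1 q.2 := by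
    have hK' := hK.continuous.comp (f := fun q : (P × X) × Y => (q.1.1, (q.1.2, q.2)))
      (by fun_prop)
    have hf' := hf.continuous.comp (f := fun q : (P × X) × Y => (q.1.1, q.2)) (by fun_prop)
    exact hK'.mul hf'
  refine continuous_iff_continuousAt.2 fun q => ?_
  obtain ⟨B, hB⟩ := hK.exists_mul_le hf (‖q.1‖ + 1)
  refine continuousAt_of_dominated (bound := fun y => (|B * w q.2| + 1) * |u y|)
    (Eventually.of_forall fun q' =>
      (hcont.comp (Continuous.prodMk_right q')).aestronglyMeasurable) ?_ (hu.abs.const_mul _)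
    (Eventually.of_forall fun y => (hcont.comp (Continuous.prodMk_left y)).continuousAt)
  have hp : ∀ᶠ q' : P × X in 𝓝 q, ‖q'.1‖ ≤ ‖q.1‖ + 1 :=
    (continuous_fst.norm.tendsto q).eventually_le_const (lt_add_one _)
  have hx : ∀ᶠ q' : P × X in 𝓝 q, |B * w q'.2| ≤ |B * w q.2| + 1 :=
    (((hw.comp continuous_snd).const_mul B).abs.tendsto q).eventually_le_const (lt_add_one _)
  filter_upwards [hp, hx] with q' hp' hx'
  refine Eventually.of_forall fun y => (hB q'.1 hp' q'.2 y).1.trans ((le_abs_self _).trans ?_)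
  rw [abs_mul]
  gcongr

variable [FiniteDimensional ℝ P]

theorem integrable_fderiv_mul {K : P → X × Y → ℝ} {f : P → Y → ℝ}
    (hK : IsDominatedFamily (fun z : X × Y => w z.1) K) (hf : IsDominatedFamily u f)
    (hu : Integrable u μ) (p : P) (x : X) :
    Integrable (fun y => fderiv ℝ (fun p => K p (x, y) * f p y) p) μ := by
  obtain ⟨B, hB⟩ := hK.exists_mul_le hf ‖p‖
  exact (hu.const_mul (B * w x)).mono'
    (aestronglyMeasurable_fderiv_of_continuous (hK.continuous_kernel_mul hf x) p)
    (Eventually.of_forall fun y => (hB p le_rfl x y).2)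

theorem contDiff_kernelIntegral {K : P → X × Y → ℝ} {f : P → Y → ℝ}
    (hK : IsDominatedFamily (fun z : X × Y => w z.1) K) (hf : IsDominatedFamily u f)
    (hu : Integrable u μ) (x : X) :
    ContDiff ℝ 1 (kernelIntegral μ K f · x) ∧ ∀ p, fderiv ℝ (kernelIntegral μ K f · x) p =
      ∫ y, fderiv ℝ (fun p => K p (x, y) * f p y) p ∂μ := by
  refine contDiff_one_integral_of_continuous (hK.continuous_kernel_mul hf x)
    (Eventually.of_forall fun y => (hK.contDiff _).mul (hf.contDiff y)) fun R => ?_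
  obtain ⟨B, hB⟩ := hK.exists_mul_le hf R
  exact ⟨_, hu.const_mul (B * w x), Eventually.of_forall fun y p hp => hB p hp x y⟩

protected theorem kernelIntegral [FirstCountableTopology X] (hw : Continuous w)
    {K : P → X × Y → ℝ} {f : P → Y → ℝ}
    (hK : IsDominatedFamily (fun z : X × Y => w z.1) K) (hf : IsDominatedFamily u f)
    (hu : Integrable u μ) : IsDominatedFamily w (kernelIntegral μ K f) := by
  refine ⟨hK.continuous_kernelIntegral hw hf hu,
    fun x => (hK.contDiff_kernelIntegral hf hu x).1, fun R => ?_⟩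
  obtain ⟨B, hB⟩ := hK.exists_mul_le hf R
  refine ⟨B * ∫ y, u y ∂μ, fun p hp x => ?_⟩
  rw [mul_right_comm, ← integral_const_mul, (hK.contDiff_kernelIntegral hf hu x).2]
  exact ⟨norm_integral_le_of_norm_le (f := fun y => K p (x, y) * f p y) (hu.const_mul _)
      (Eventually.of_forall fun y => (hB p hp x y).1),
    norm_integral_le_of_norm_le (hu.const_mul _) (Eventually.of_forall fun y => (hB p hp x y).2)⟩

end IsDominatedFamily

end DominatedFamily

section UniformContraction

variable {P X : Type*} [TopologicalSpace X] [MeasurableSpace X] {μ : Measure X} {τ : X → ℝ}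
  {K : P → X × X → ℝ}

/-- The kernels `K p` act on `L¹(τ μ)` as contractions, with a factor independent of `p`. -/
structure IsUniformContraction (μ : Measure X) (τ : X → ℝ) (K : P → X × X → ℝ) : Prop where
  continuous_weight : Continuous τ
  bounds : ∃ τ₁ τ₂ : ℝ, 0 < τ₁ ∧ ∀ x, τ₁ ≤ τ x ∧ τ x ≤ τ₂
  contracts : ∃ ρ : ℝ, 0 ≤ ρ ∧ ρ < 1 ∧ ∀ p y, ∫ x, τ x * |K p (x, y)| ∂μ ≤ ρ * τ y

theorem IsUniformContraction.weight_pos (hτ : IsUniformContraction μ τ K) (x : X) : 0 < τ x := by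
  obtain ⟨τ₁, τ₂, hτ₁, hbd⟩ := hτ.bounds
  exact hτ₁.trans_le (hbd x).1

theorem IsUniformContraction.integrable_mul [BorelSpace X] {g : X → ℝ}
    (hτ : IsUniformContraction μ τ K) (hg : Integrable g μ) :
    Integrable (fun x => τ x * g x) μ := by
  obtain ⟨τ₁, τ₂, hτ₁, hbd⟩ := hτ.bounds
  refine hg.bdd_mul (c := τ₂) hτ.continuous_weight.aestronglyMeasurable
    (Eventually.of_forall fun x => ?_)
  rw [Real.norm_of_nonneg (hτ₁.le.trans (hbd x).1)]
  exact (hbd x).2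

end UniformContraction

section Neumann

variable {P X Y : Type*} [NormedAddCommGroup P] [NormedSpace ℝ P]

theorem integral_count_eq_tsum (f : ℕ → ℝ) : ∫ n, f n ∂Measure.count = ∑' n, f n := by
  simpa [Measure.count] using integral_sum_dirac (c := fun _ => 1) (x := id) (f := f) (by simp)

theorem IsDominatedFamily.tsum [FiniteDimensional ℝ P] [TopologicalSpace X] {w : X → ℝ}
    (hw : Continuous w) {f : ℕ → P → X → ℝ}
    (hf : ∀ n, IsDominatedFamily w (f n))
    (hb : ∀ R, ∃ c : ℕ → ℝ, Summable c ∧ ∀ n p, ‖p‖ ≤ R → ∀ x,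
      |f n p x| ≤ c n * w x ∧ ‖fderiv ℝ (f n · x) p‖ ≤ c n * w x) :
    IsDominatedFamily w fun p x => ∑' n, f n p x := by
  have hC1 := fun x => contDiff_one_integral_of_continuous (μ := Measure.count)
    (f := fun (p : P) n => f n p x)
    (continuous_prod_of_discrete_right.2 fun n => ((hf n).contDiff x).continuous)
    (Eventually.of_forall fun n => (hf n).contDiff x) fun R => by
      obtain ⟨c, hc, hcf⟩ := hb R
      exact ⟨fun n => c n * w x, integrable_count_iff.2 (hc.mul_right (w x)).norm,
        Eventually.of_forall fun n p hp => hcf n p hp x⟩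
  simp only [integral_count_eq_tsum] at hC1
  refine ⟨?_, fun x => (hC1 x).1, fun R => ?_⟩
  · refine continuous_iff_continuousAt.2 fun q => ?_
    obtain ⟨c, hc, hcf⟩ := hb (‖q.1‖ + 1)
    have hp : ∀ᶠ q' : P × X in 𝓝 q, ‖q'.1‖ ≤ ‖q.1‖ + 1 :=
      (continuous_fst.norm.tendsto q).eventually_le_const (lt_add_one _)
    have hx : ∀ᶠ q' : P × X in 𝓝 q, |w q'.2| ≤ |w q.2| + 1 :=
      ((hw.comp continuous_snd).abs.tendsto q).eventually_le_const (lt_add_one _)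
    refine (continuousOn_tsum (u := fun n => |c n| * (|w q.2| + 1))
      (fun n => (hf n).continuous.continuousOn) (hc.abs.mul_right _) ?_).continuousAt (hp.and hx)
    rintro n q' ⟨hp', hx'⟩
    refine (hcf n q'.1 hp' q'.2).1.trans ((le_abs_self _).trans ?_)
    rw [abs_mul]
    gcongr
  · obtain ⟨c, hc, hcf⟩ := hb R
    refine ⟨∑' n, c n, fun p hp x => ?_⟩
    have hsum := hc.mul_right (w x)
    rw [← tsum_mul_right]
    refine ⟨tsum_of_norm_bounded (f := fun n => f n p x) hsum.hasSum fun n => (hcf n p hp x).1, ?_⟩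
    rw [(hC1 x).2, ← integral_count_eq_tsum]
    exact norm_integral_le_of_norm_le (integrable_count_iff.2 hsum.norm)
      (Eventually.of_forall fun n => (hcf n p hp x).2)

/-- The size `|f| + ε ‖∂_p f‖` of a family and of its derivative at `p`. It is submultiplicative
for every `ε`, and a small `ε` makes the contribution of the derivative harmless. -/
noncomputable def jetNorm (ε : ℝ) (f : P → X → ℝ) (p : P) (x : X) : ℝ :=
  |f p x| + ε * ‖fderiv ℝ (f · x) p‖

theorem jetNorm_nonneg {ε : ℝ} (hε : 0 ≤ ε) (f : P → X → ℝ) (p : P) (x : X) :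
    0 ≤ jetNorm ε f p x := by
  unfold jetNorm
  positivity

theorem integral_mul_integral_mul_le [MeasurableSpace X] {μ : Measure X} [SFinite μ]
    {τ c g : X → ℝ} {k : X × X → ℝ}
    (hint : Integrable (fun z : X × X => τ z.1 * k z * g z.2) (μ.prod μ)) (hg : ∀ y, 0 ≤ g y)
    (hcg : Integrable (fun y => c y * g y) μ) (hc : ∀ y, ∫ x, τ x * k (x, y) ∂μ ≤ c y) :
    ∫ x, τ x * ∫ y, k (x, y) * g y ∂μ ∂μ ≤ ∫ y, c y * g y ∂μ := by
  simp only [← integral_const_mul, ← mul_assoc]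
  rw [integral_integral_swap hint]
  refine integral_mono hint.integral_prod_right hcg fun y => ?_
  change ∫ x, τ x * k (x, y) * g y ∂μ ≤ _
  rw [integral_mul_const]
  exact mul_le_mul_of_nonneg_right (hc y) (hg y)

namespace IsDominatedFamily

variable [TopologicalSpace X] [TopologicalSpace Y] {w : X → ℝ} {u : Y → ℝ}

theorem comp_continuous {f : P → X → ℝ} (hf : IsDominatedFamily w f) {φ : Y → X}
    (hφ : Continuous φ) : IsDominatedFamily (fun y => w (φ y)) fun p y => f p (φ y) where
  continuous := hf.continuous.comp (continuous_fst.prodMk (hφ.comp continuous_snd))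
  contDiff y := hf.contDiff (φ y)
  bound R := (hf.bound R).imp fun _ hB p hp y => hB p hp (φ y)

theorem exists_jetNorm_le {f : P → X → ℝ} (hf : IsDominatedFamily w f) {ε : ℝ} (hε : 0 ≤ ε)
    (R : ℝ) : ∃ B, ∀ p, ‖p‖ ≤ R → ∀ x, jetNorm ε f p x ≤ B * w x := by
  obtain ⟨B, hB⟩ := hf.bound R
  refine ⟨(1 + ε) * B, fun p hp x => ?_⟩
  have h := hB p hp x
  calc jetNorm ε f p x ≤ B * w x + ε * (B * w x) :=
        add_le_add h.1 (mul_le_mul_of_nonneg_left h.2 hε)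
    _ = _ := by ring

theorem aestronglyMeasurable_jetNorm [FiniteDimensional ℝ P] [MeasurableSpace X]
    [OpensMeasurableSpace X] {μ : Measure X} {f : P → X → ℝ} (hf : IsDominatedFamily w f) (ε : ℝ)
    (p : P) : AEStronglyMeasurable (jetNorm ε f p) μ :=
  (hf.continuous_apply p).abs.aestronglyMeasurable.add
    ((aestronglyMeasurable_fderiv_of_continuous hf.continuous p).norm.const_mul ε)

theorem integrable_apply [MeasurableSpace X] [OpensMeasurableSpace X] {μ : Measure X}
    {f : P → X → ℝ} (hf : IsDominatedFamily w f) (hw : Integrable w μ) (p : P) :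
    Integrable (f p) μ := by
  obtain ⟨B, hB⟩ := hf.bound ‖p‖
  exact (hw.const_mul B).mono' (hf.continuous_apply p).aestronglyMeasurable
    (Eventually.of_forall fun x => (hB p le_rfl x).1)

theorem integrable_fderiv [FiniteDimensional ℝ P] [MeasurableSpace X] [OpensMeasurableSpace X]
    {μ : Measure X} {f : P → X → ℝ} (hf : IsDominatedFamily w f) (hw : Integrable w μ) (p : P) :
    Integrable (fun x => fderiv ℝ (f · x) p) μ := by
  obtain ⟨B, hB⟩ := hf.bound ‖p‖
  exact (hw.const_mul B).mono' (aestronglyMeasurable_fderiv_of_continuous hf.continuous p)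
    (Eventually.of_forall fun x => (hB p le_rfl x).2)

theorem integrable_jetNorm [FiniteDimensional ℝ P] [MeasurableSpace X] [OpensMeasurableSpace X]
    {μ : Measure X} {f : P → X → ℝ} (hf : IsDominatedFamily w f) (hw : Integrable w μ) (ε : ℝ)
    (p : P) : Integrable (jetNorm ε f p) μ :=
  (hf.integrable_apply hw p).abs.add ((hf.integrable_fderiv hw p).norm.const_mul ε)

theorem jetNorm_mul_le {K : P → X × Y → ℝ} {f : P → Y → ℝ}
    (hK : IsDominatedFamily (fun z : X × Y => w z.1) K) (hf : IsDominatedFamily u f) {ε : ℝ}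
    (hε : 0 ≤ ε) (p : P) (x : X) (y : Y) :
    |K p (x, y) * f p y| + ε * ‖fderiv ℝ (fun p => K p (x, y) * f p y) p‖ ≤
      jetNorm ε K p (x, y) * jetNorm ε f p y := by
  have h := mul_le_mul_of_nonneg_left (hK.norm_fderiv_mul_le hf p x y) hε
  have h' : 0 ≤ ε * ‖fderiv ℝ (K · (x, y)) p‖ * (ε * ‖fderiv ℝ (f · y) p‖) := by positivity
  rw [abs_mul, jetNorm, jetNorm]
  linarith

variable [MeasurableSpace Y] [OpensMeasurableSpace Y] {μ : Measure Y} [FiniteDimensional ℝ P]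

theorem integrable_jetNorm_mul {K : P → X × Y → ℝ} {f : P → Y → ℝ}
    (hK : IsDominatedFamily (fun z : X × Y => w z.1) K) (hf : IsDominatedFamily u f)
    (hu : Integrable u μ) {ε : ℝ} (hε : 0 ≤ ε) (p : P) (x : X) :
    Integrable (fun y => jetNorm ε K p (x, y) * jetNorm ε f p y) μ := by
  obtain ⟨B, hB⟩ := hK.exists_jetNorm_le hε ‖p‖
  exact (hf.integrable_jetNorm hu ε p).bdd_mul (c := B * w x)
    ((hK.comp_continuous (Continuous.prodMk_right x)).aestronglyMeasurable_jetNorm ε p)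
    (Eventually.of_forall fun y => by
      rw [Real.norm_of_nonneg (jetNorm_nonneg hε _ _ _)]
      exact hB p le_rfl (x, y))

theorem jetNorm_kernelIntegral_le {K : P → X × Y → ℝ} {f : P → Y → ℝ}
    (hK : IsDominatedFamily (fun z : X × Y => w z.1) K) (hf : IsDominatedFamily u f)
    (hu : Integrable u μ) {ε : ℝ} (hε : 0 ≤ ε) (p : P) (x : X) :
    jetNorm ε (kernelIntegral μ K f) p x ≤ ∫ y, jetNorm ε K p (x, y) * jetNorm ε f p y ∂μ := by
  have hint := hK.integrable_jetNorm_mul hf hu hε p x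
  have hint₀ := hK.integrable_kernel_mul hf hu p x
  have hint₁ := hK.integrable_fderiv_mul hf hu p x
  calc jetNorm ε (kernelIntegral μ K f) p x
      ≤ (∫ y, |K p (x, y) * f p y| ∂μ) +
          ε * ∫ y, ‖fderiv ℝ (fun p => K p (x, y) * f p y) p‖ ∂μ := by
        rw [jetNorm, (hK.contDiff_kernelIntegral hf hu x).2]
        gcongr
        · exact abs_integral_le_integral_abs
        · exact norm_integral_le_integral_norm _
    _ = ∫ y, (|K p (x, y) * f p y| + ε * ‖fderiv ℝ (fun p => K p (x, y) * f p y) p‖) ∂μ := by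
        rw [integral_add hint₀.abs (hint₁.norm.const_mul ε), integral_const_mul]
    _ ≤ ∫ y, jetNorm ε K p (x, y) * jetNorm ε f p y ∂μ :=
        integral_mono (hint₀.abs.add (hint₁.norm.const_mul ε)) hint fun y =>
          hK.jetNorm_mul_le hf hε p x y

end IsDominatedFamily

section Iteration

variable [TopologicalSpace X] [MeasurableSpace X] [BorelSpace X] {μ : Measure X} {w τ : X → ℝ}
  {K : P → X × X → ℝ}

theorem IsUniformContraction.exists_integral_fderiv_le (hτ : IsUniformContraction μ τ K)
    (hK : IsDominatedFamily (fun z : X × X => w z.1) K) (hw : Integrable w μ) (R : ℝ) :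
    ∃ D, 0 ≤ D ∧ ∀ p, ‖p‖ ≤ R → ∀ y, ∫ x, τ x * ‖fderiv ℝ (K · (x, y)) p‖ ∂μ ≤ D * τ y := by
  obtain ⟨τ₁, τ₂, hτ₁, hbd⟩ := hτ.bounds
  obtain ⟨B, hB⟩ := hK.bound R
  refine ⟨|∫ x, τ x * (B * w x) ∂μ| / τ₁, by positivity, fun p hp y => ?_⟩
  calc ∫ x, τ x * ‖fderiv ℝ (K · (x, y)) p‖ ∂μ ≤ ∫ x, τ x * (B * w x) ∂μ :=
        integral_mono_of_nonneg
          (Eventually.of_forall fun x => mul_nonneg (hτ.weight_pos x).le (norm_nonneg _))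
          (hτ.integrable_mul (hw.const_mul B)) (Eventually.of_forall fun x =>
            mul_le_mul_of_nonneg_left (hB p hp (x, y)).2 (hτ.weight_pos x).le)
    _ ≤ |∫ x, τ x * (B * w x) ∂μ| / τ₁ * τ₁ := by
        rw [div_mul_cancel₀ _ hτ₁.ne']
        exact le_abs_self _
    _ ≤ |∫ x, τ x * (B * w x) ∂μ| / τ₁ * τ y := by
        gcongr
        exact (hbd y).1

variable [FiniteDimensional ℝ P]

theorem IsUniformContraction.exists_integral_jetNorm_le (hτ : IsUniformContraction μ τ K)
    (hK : IsDominatedFamily (fun z : X × X => w z.1) K) (hw : Integrable w μ) (R : ℝ) :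
    ∃ ε r : ℝ, 0 < ε ∧ 0 ≤ r ∧ r < 1 ∧ ∀ p, ‖p‖ ≤ R → ∀ y,
      ∫ x, τ x * jetNorm ε K p (x, y) ∂μ ≤ r * τ y := by
  obtain ⟨ρ, hρ0, hρ1, hρ⟩ := hτ.contracts
  obtain ⟨D, hD0, hD⟩ := hτ.exists_integral_fderiv_le hK hw R
  have hε : 0 < (1 - ρ) / (2 * (D + 1)) := div_pos (by linarith) (by linarith)
  refine ⟨(1 - ρ) / (2 * (D + 1)), (1 + ρ) / 2, hε, by linarith, by linarith, fun p hp y => ?_⟩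
  have hcol : IsDominatedFamily w fun p x => K p (x, y) :=
    hK.comp_continuous (Continuous.prodMk_left y)
  have hint₀ := hτ.integrable_mul (hcol.integrable_apply hw p).abs
  have hint₁ := (hτ.integrable_mul (hcol.integrable_fderiv hw p).norm).const_mul
    ((1 - ρ) / (2 * (D + 1)))
  have hεD : (1 - ρ) / (2 * (D + 1)) * D ≤ (1 - ρ) / 2 := by
    rw [div_mul_eq_mul_div, div_le_div_iff₀ (by positivity) two_pos]
    nlinarith
  calc ∫ x, τ x * jetNorm ((1 - ρ) / (2 * (D + 1))) K p (x, y) ∂μ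
      = ∫ x, τ x * |K p (x, y)| ∂μ +
          (1 - ρ) / (2 * (D + 1)) * ∫ x, τ x * ‖fderiv ℝ (K · (x, y)) p‖ ∂μ := by
        rw [← integral_const_mul, ← integral_add hint₀ hint₁]
        congr 1 with x
        rw [jetNorm]
        ring
    _ ≤ ρ * τ y + (1 - ρ) / (2 * (D + 1)) * (D * τ y) := by
        gcongr
        · exact hρ p y
        · exact hD p hp y
    _ ≤ (1 + ρ) / 2 * τ y := by nlinarith [hτ.weight_pos y]

theorem IsUniformContraction.integral_jetNorm_kernelIntegral_le [SecondCountableTopology X]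
    [SFinite μ] (hτ : IsUniformContraction μ τ K)
    (hK : IsDominatedFamily (fun z : X × X => w z.1) K) (hw : Integrable w μ) {f : P → X → ℝ}
    (hf : IsDominatedFamily w f) {ε r : ℝ} (hε : 0 ≤ ε) {p : P}
    (hr : ∀ y, ∫ x, τ x * jetNorm ε K p (x, y) ∂μ ≤ r * τ y) :
    ∫ x, τ x * jetNorm ε (kernelIntegral μ K f) p x ∂μ ≤ r * ∫ y, τ y * jetNorm ε f p y ∂μ := by
  have hfint := hf.integrable_jetNorm hw ε p
  obtain ⟨B, hB⟩ := hK.exists_jetNorm_le hε ‖p‖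
  have hprod : Integrable (fun z : X × X => τ z.1 * jetNorm ε K p z * jetNorm ε f p z.2)
      (μ.prod μ) := by
    refine ((hτ.integrable_mul (hw.const_mul B)).mul_prod hfint).mono'
      (((hτ.continuous_weight.comp continuous_fst).aestronglyMeasurable.mul
        (hK.aestronglyMeasurable_jetNorm ε p)).mul hfint.aestronglyMeasurable.comp_snd)
      (Eventually.of_forall fun z => ?_)
    have hτz := (hτ.weight_pos z.1).le
    have hfz := jetNorm_nonneg hε f p z.2
    rw [Real.norm_of_nonneg (mul_nonneg (mul_nonneg hτz (jetNorm_nonneg hε K p z)) hfz)]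
    have := hB p le_rfl z
    gcongr
  have hmul := hτ.integrable_mul hfint
  calc ∫ x, τ x * jetNorm ε (kernelIntegral μ K f) p x ∂μ
      ≤ ∫ x, τ x * ∫ y, jetNorm ε K p (x, y) * jetNorm ε f p y ∂μ ∂μ := by
        refine integral_mono_of_nonneg (Eventually.of_forall fun x =>
          mul_nonneg (hτ.weight_pos x).le (jetNorm_nonneg hε _ p x)) ?_
          (Eventually.of_forall fun x => mul_le_mul_of_nonneg_left
            (hK.jetNorm_kernelIntegral_le hf hw hε p x) (hτ.weight_pos x).le)
        simpa only [mul_assoc, integral_const_mul] using hprod.integral_prod_left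
    _ ≤ ∫ y, r * τ y * jetNorm ε f p y ∂μ :=
        integral_mul_integral_mul_le hprod (jetNorm_nonneg hε f p)
          (by simpa only [mul_assoc] using hmul.const_mul r) hr
    _ = r * ∫ y, τ y * jetNorm ε f p y ∂μ := by
        simp only [mul_assoc, integral_const_mul]

end Iteration

end Neumann

section NeumannSeries

variable {P X : Type*} [NormedAddCommGroup P] [NormedSpace ℝ P]
  [TopologicalSpace X] [MeasurableSpace X] [BorelSpace X]
  {μ : Measure X} {w τ : X → ℝ} {K : P → X × X → ℝ} {h : P → X → ℝ}

theorem IsDominatedFamily.kernelIntegral_tsum (hK : IsDominatedFamily (fun z : X × X => w z.1) K)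
    (hw : Integrable w μ) {f : ℕ → P → X → ℝ} (hf : ∀ n, IsDominatedFamily w (f n)) {c : ℕ → ℝ}
    (hc : Summable c) {p : P} (hcw : ∀ n y, |f n p y| ≤ c n * w y) (x : X) :
    kernelIntegral μ K (fun p y => ∑' n, f n p y) p x = ∑' n, kernelIntegral μ K (f n) p x := by
  have hint n : Integrable (fun y => K p (x, y) * f n p y) μ :=
    hK.integrable_kernel_mul (hf n) hw p x
  obtain ⟨B, hB⟩ := hK.bound ‖p‖
  have hnorm : Summable fun n => ∫ y, ‖K p (x, y) * f n p y‖ ∂μ := by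
    refine (hc.mul_right (B * w x * ∫ y, w y ∂μ)).of_nonneg_of_le
      (fun n => integral_nonneg fun y => norm_nonneg _) fun n => ?_
    rw [mul_left_comm, ← integral_const_mul, ← integral_const_mul]
    refine integral_mono (hint n).norm ((hw.const_mul _).const_mul _) fun y => ?_
    rw [norm_mul]
    exact mul_le_mul (hB p le_rfl (x, y)).1 (hcw n y) (norm_nonneg _)
      ((abs_nonneg _).trans (hB p le_rfl (x, y)).1)
  simp only [kernelIntegral, ← tsum_mul_left]
  exact (integral_tsum_of_summable_integral_norm hint hnorm).symm

variable [FiniteDimensional ℝ P]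

theorem IsDominatedFamily.iterate_kernelIntegral [FirstCountableTopology X]
    (hK : IsDominatedFamily (fun z : X × X => w z.1) K) (hwc : Continuous w)
    (hw : Integrable w μ) (hh : IsDominatedFamily w h) (n : ℕ) :
    IsDominatedFamily w ((kernelIntegral μ K)^[n] h) := by
  induction n with
  | zero => exact hh
  | succ n ih =>
    rw [Function.iterate_succ_apply']
    exact .kernelIntegral hwc hK ih hw

theorem IsDominatedFamily.jetNorm_kernelIntegral_le_mul_integral
    (hK : IsDominatedFamily (fun z : X × X => w z.1) K) (hw : Integrable w μ)
    (hh : IsDominatedFamily w h) {ε B : ℝ} (hε : 0 ≤ ε) {p : P}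
    (hB : ∀ z, jetNorm ε K p z ≤ B * w z.1) (x : X) :
    jetNorm ε (kernelIntegral μ K h) p x ≤ B * w x * ∫ y, jetNorm ε h p y ∂μ := by
  rw [← integral_const_mul]
  exact (hK.jetNorm_kernelIntegral_le hh hw hε p x).trans
    (integral_mono (hK.integrable_jetNorm_mul hh hw hε p x)
      ((hh.integrable_jetNorm hw ε p).const_mul _) fun y =>
        mul_le_mul_of_nonneg_right (hB (x, y)) (jetNorm_nonneg hε h p y))

namespace IsUniformContraction

variable [SecondCountableTopology X] [SFinite μ] (hτ : IsUniformContraction μ τ K)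
  (hK : IsDominatedFamily (fun z : X × X => w z.1) K) (hwc : Continuous w) (hw : Integrable w μ)
  (hh : IsDominatedFamily w h)

include hτ hK hwc hw hh

theorem integral_jetNorm_iterate_le {ε r : ℝ} (hε : 0 ≤ ε) (hr₀ : 0 ≤ r) {p : P}
    (hr : ∀ y, ∫ x, τ x * jetNorm ε K p (x, y) ∂μ ≤ r * τ y) (n : ℕ) :
    ∫ x, τ x * jetNorm ε ((kernelIntegral μ K)^[n] h) p x ∂μ ≤
      r ^ n * ∫ x, τ x * jetNorm ε h p x ∂μ := by
  induction n with
  | zero => simp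
  | succ n ih =>
    rw [Function.iterate_succ_apply', pow_succ', mul_assoc]
    exact (hτ.integral_jetNorm_kernelIntegral_le hK hw
      (hK.iterate_kernelIntegral hwc hw hh n) hε hr).trans (mul_le_mul_of_nonneg_left ih hr₀)

theorem exists_integral_jetNorm_iterate_le (R : ℝ) :
    ∃ ε r D : ℝ, 0 < ε ∧ 0 ≤ r ∧ r < 1 ∧ ∀ n p, ‖p‖ ≤ R →
      ∫ x, jetNorm ε ((kernelIntegral μ K)^[n] h) p x ∂μ ≤ D * r ^ n := by
  obtain ⟨τ₁, τ₂, hτ₁, hbd⟩ := hτ.bounds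
  obtain ⟨ε, r, hε, hr₀, hr₁, hr⟩ := hτ.exists_integral_jetNorm_le hK hw R
  obtain ⟨B, hB⟩ := hh.exists_jetNorm_le hε.le R
  refine ⟨ε, r, (∫ x, τ x * (B * w x) ∂μ) / τ₁, hε, hr₀, hr₁, fun n p hp => ?_⟩
  have hterm := (hK.iterate_kernelIntegral hwc hw hh n).integrable_jetNorm hw ε p
  have hle : ∫ x, τ x * jetNorm ε h p x ∂μ ≤ ∫ x, τ x * (B * w x) ∂μ :=
    integral_mono (hτ.integrable_mul (hh.integrable_jetNorm hw ε p))
      (hτ.integrable_mul (hw.const_mul B)) fun x =>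
        mul_le_mul_of_nonneg_left (hB p hp x) (hτ.weight_pos x).le
  rw [div_mul_eq_mul_div, le_div_iff₀ hτ₁, mul_comm, mul_comm _ (r ^ n), ← integral_const_mul]
  calc ∫ x, τ₁ * jetNorm ε ((kernelIntegral μ K)^[n] h) p x ∂μ
      ≤ ∫ x, τ x * jetNorm ε ((kernelIntegral μ K)^[n] h) p x ∂μ :=
        integral_mono (hterm.const_mul _) (hτ.integrable_mul hterm) fun x =>
          mul_le_mul_of_nonneg_right (hbd x).1 (jetNorm_nonneg hε.le _ p x)
    _ ≤ r ^ n * ∫ x, τ x * jetNorm ε h p x ∂μ :=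
        hτ.integral_jetNorm_iterate_le hK hwc hw hh hε.le hr₀ (hr p hp) n
    _ ≤ r ^ n * ∫ x, τ x * (B * w x) ∂μ := by gcongr

theorem exists_jetNorm_iterate_le (R : ℝ) :
    ∃ ε > 0, ∃ c : ℕ → ℝ, Summable c ∧ ∀ n p, ‖p‖ ≤ R → ∀ x,
      jetNorm ε ((kernelIntegral μ K)^[n] h) p x ≤ c n * w x := by
  obtain ⟨ε, r, D, hε, hr₀, hr₁, hD⟩ := hτ.exists_integral_jetNorm_iterate_le hK hwc hw hh R
  obtain ⟨B₀, hB₀⟩ := hh.exists_jetNorm_le hε.le R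
  obtain ⟨B, hB⟩ := hK.exists_jetNorm_le hε.le R
  refine ⟨ε, hε, fun n => n.casesOn B₀ fun n => B * D * r ^ n, (summable_nat_add_iff 1).1
    ((summable_geometric_of_lt_one hr₀ hr₁).mul_left (B * D)), fun n p hp x => ?_⟩
  cases n with
  | zero => exact hB₀ p hp x
  | succ n =>
    have hBw : 0 ≤ B * w x := (jetNorm_nonneg hε.le K p (x, x)).trans (hB p hp (x, x))
    rw [Function.iterate_succ_apply']
    calc _ ≤ B * w x * ∫ y, jetNorm ε ((kernelIntegral μ K)^[n] h) p y ∂μ :=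
          hK.jetNorm_kernelIntegral_le_mul_integral hw (hK.iterate_kernelIntegral hwc hw hh n)
            hε.le (hB p hp) x
      _ ≤ B * w x * (D * r ^ n) := mul_le_mul_of_nonneg_left (hD n p hp) hBw
      _ = B * D * r ^ n * w x := by ring

theorem exists_iterate_bound (R : ℝ) :
    ∃ c : ℕ → ℝ, Summable c ∧ ∀ n p, ‖p‖ ≤ R → ∀ x,
      |(kernelIntegral μ K)^[n] h p x| ≤ c n * w x ∧
        ‖fderiv ℝ ((kernelIntegral μ K)^[n] h · x) p‖ ≤ c n * w x := by
  obtain ⟨ε, hε, c, hc, hcw⟩ := hτ.exists_jetNorm_iterate_le hK hwc hw hh R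
  refine ⟨fun n => (1 + ε⁻¹) * c n, hc.mul_left _, fun n p hp x => ?_⟩
  have hle := hcw n p hp x
  have hcw₀ : 0 ≤ c n * w x := (jetNorm_nonneg hε.le _ p x).trans hle
  have h₀ := abs_nonneg ((kernelIntegral μ K)^[n] h p x)
  have h₁ := norm_nonneg (fderiv ℝ ((kernelIntegral μ K)^[n] h · x) p)
  rw [jetNorm] at hle
  beta_reduce
  rw [mul_assoc, add_mul, one_mul]
  have hεcw : 0 ≤ ε⁻¹ * (c n * w x) := by positivity
  have hderiv : ‖fderiv ℝ ((kernelIntegral μ K)^[n] h · x) p‖ ≤ ε⁻¹ * (c n * w x) := by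
    rw [inv_mul_eq_div, le_div_iff₀' hε]
    linarith
  constructor
  · linarith [mul_nonneg hε.le h₁]
  · linarith

theorem exists_eq_add_kernelIntegral (hK₀ : ∀ p z, 0 ≤ K p z) (hh₀ : ∀ p x, 0 ≤ h p x) :
    ∃ f, IsDominatedFamily w f ∧ (∀ p x, f p x = h p x + kernelIntegral μ K f p x) ∧
      ∀ p x, h p x ≤ f p x := by
  have hf := hK.iterate_kernelIntegral hwc hw hh
  have hpos : ∀ n p x, 0 ≤ (kernelIntegral μ K)^[n] h p x := fun n => by
    induction n with
    | zero => exact hh₀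
    | succ n ih =>
      rw [Function.iterate_succ_apply']
      exact fun p x => integral_nonneg fun y => mul_nonneg (hK₀ p _) (ih p y)
  have hbound := hτ.exists_iterate_bound hK hwc hw hh
  have hsum : ∀ p x, Summable fun n => (kernelIntegral μ K)^[n] h p x := fun p x => by
    obtain ⟨c, hc, hcw⟩ := hbound ‖p‖
    exact (hc.mul_right (w x)).of_norm_bounded fun n => (hcw n p le_rfl x).1
  refine ⟨fun p x => ∑' n, (kernelIntegral μ K)^[n] h p x, .tsum hwc hf hbound, fun p x => ?_,
    fun p x => (hsum p x).le_tsum 0 fun n _ => hpos n p x⟩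
  obtain ⟨c, hc, hcw⟩ := hbound ‖p‖
  rw [hK.kernelIntegral_tsum hw hf hc fun n y => (hcw n p le_rfl y).1]
  exact (hsum p x).tsum_eq_zero_add.trans
    (by simp only [Function.iterate_succ_apply', Function.iterate_zero, id])

end IsUniformContraction

end NeumannSeries

section TransportResolvent

variable {V : Type*} [NormedAddCommGroup V] [NormedSpace ℝ V] {ν m h : V → ℝ} {a : ℝ}

theorem IsTransportSource.mul_of_fderiv_le (hh : IsTransportSource m a h) (hm : ∀ v, 0 < m v)
    {g : V → ℝ} (hg : ContDiff ℝ 1 g) {b B : ℝ} (hb : ∀ v, |g v| ≤ b)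
    (hB : ∀ v, ‖fderiv ℝ g v‖ ≤ B / (1 + ‖v‖)) :
    IsTransportSource m (a * (b + B)) fun v => h v * g v := by
  have ha : 0 ≤ a := nonneg_of_mul_nonneg_left ((abs_nonneg _).trans (hh.abs_le 0)) (hm 0)
  have hB₀ : 0 ≤ B := by simpa using (norm_nonneg _).trans (hB 0)
  refine ⟨hh.contDiff.mul hg, fun v => ?_, fun v => ?_⟩
  · have hmv := (hm v).le
    calc |h v * g v| ≤ a * m v * b := by
          rw [abs_mul]
          exact mul_le_mul (hh.abs_le v) (hb v) (abs_nonneg _) (by positivity)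
      _ ≤ a * m v * b + a * m v * B := le_add_of_nonneg_right (by positivity)
      _ = a * (b + B) * m v := by ring
  · have hmv := (hm v).le
    have hb₀ := (abs_nonneg _).trans (hb v)
    rw [fderiv_fun_mul (hh.contDiff.differentiable one_ne_zero v)
      (hg.differentiable one_ne_zero v)]
    refine (norm_add_le _ _).trans ?_
    rw [norm_smul, norm_smul, Real.norm_eq_abs, Real.norm_eq_abs]
    calc |h v| * ‖fderiv ℝ g v‖ + |g v| * ‖fderiv ℝ h v‖
        ≤ a * m v * (B / (1 + ‖v‖)) + b * (a * (m v / (1 + ‖v‖))) := by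
          gcongr
          exacts [hh.abs_le v, hB v, hb v, hh.norm_fderiv_le v]
      _ = a * (b + B) * (m v / (1 + ‖v‖)) := by ring

theorem transportResolvent_const_mul (ν : V → ℝ) (E : V) (c : ℝ) (h : V → ℝ) (v : V) :
    transportResolvent ν E (fun v => c * h v) v = c * transportResolvent ν E h v := by
  simp only [transportResolvent, attenuated, ← integral_const_mul, mul_left_comm]

theorem transportResolvent_nonneg (ν : V → ℝ) (E : V) (hh : ∀ v, 0 ≤ h v) (v : V) :
    0 ≤ transportResolvent ν E h v :=
  integral_nonneg fun _ => mul_nonneg (Real.exp_nonneg _) (hh _)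

namespace IsAbsorptionRate

variable (hν : IsAbsorptionRate ν) (hm : IsModerateWeight m)
include hν hm

theorem transportResolvent_add {g : V → ℝ} (hh : Continuous h) (ha : ∀ v, |h v| ≤ a * m v)
    (hg : Continuous g) {b : ℝ} (hb : ∀ v, |g v| ≤ b * m v) (E v : V) :
    transportResolvent ν E (fun v => h v + g v) v =
      transportResolvent ν E h v + transportResolvent ν E g v := by
  unfold transportResolvent
  rw [← integral_add (hν.integrableOn_attenuated hm hh ha (E, v))
    (hν.integrableOn_attenuated hm hg hb (E, v))]
  simp only [attenuated, mul_add]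

theorem transportResolvent_integral [MeasurableSpace V] [BorelSpace V] [SecondCountableTopology V]
    {μ : Measure V} [SFinite μ]
    {H : V → V → ℝ} (hH : Continuous H.uncurry) (ha : ∀ u v, |H u v| ≤ a * m v) {f : V → ℝ}
    (hf : Integrable f μ) (E v : V) :
    transportResolvent ν E (fun v => ∫ u, H u v * f u ∂μ) v =
      ∫ u, transportResolvent ν E (H u) v * f u ∂μ := by
  obtain ⟨b, hbi, hb⟩ := hν.exists_abs_attenuated_le hm ‖E‖
  have hcont : Continuous fun q : ℝ × V => attenuated ν (H q.2) (E, v) q.1 :=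
    (continuous_attenuated hν.continuous hH).comp
      ((continuous_const.prodMk continuous_snd).prodMk continuous_fst)
  have hint : Integrable (fun q : ℝ × V => attenuated ν (H q.2) (E, v) q.1 * f q.2)
      ((volume.restrict (Set.Ioi 0)).prod μ) := by
    refine (((hbi.const_mul a).mul_const (m v)).mul_prod hf.norm).mono'
      (hcont.aestronglyMeasurable.mul hf.aestronglyMeasurable.comp_snd) ?_
    have hpos : ∀ᵐ q : ℝ × V ∂(volume.restrict (Set.Ioi 0)).prod μ, 0 < q.1 :=
      Measure.quasiMeasurePreserving_fst.ae (self_mem_ae_restrict measurableSet_Ioi)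
    filter_upwards [hpos] with q hq
    rw [norm_mul]
    exact mul_le_mul_of_nonneg_right (hb a _ (ha q.2) (E, v) q.1 le_rfl hq.le) (norm_nonneg _)
  simp only [transportResolvent, ← integral_mul_const]
  rw [← integral_integral_swap hint]
  simp only [attenuated, ← integral_const_mul, mul_assoc]

theorem integrable_transportResolvent [FiniteDimensional ℝ V] [MeasurableSpace V] [BorelSpace V]
    {μ : Measure V} (hmi : Integrable m μ) (hh : IsTransportSource m a h) (E : V) :
    Integrable (transportResolvent ν E h) μ := by
  obtain ⟨C, hC⟩ := hν.exists_abs_transportResolvent_le hm ‖E‖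
  exact (hmi.const_mul (a * C)).mono'
    (((hν.contDiff_transportResolvent hm hh).1.continuous.comp
      (Continuous.prodMk_right E)).aestronglyMeasurable)
    (Eventually.of_forall (hC a h hh.abs_le E le_rfl))

variable [FiniteDimensional ℝ V]

theorem contDiff_transportResolvent_apply (hh : IsTransportSource m a h) (E : V) :
    ContDiff ℝ 1 (transportResolvent ν E h) :=
  (hν.contDiff_transportResolvent hm hh).1.comp (contDiff_const.prodMk contDiff_id)

theorem fderiv_transportResolvent_apply (hh : IsTransportSource m a h) (E v : V) :
    fderiv ℝ (transportResolvent ν E h) v E = h v - ν v * transportResolvent ν E h v :=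
  ((hν.contDiff_transportResolvent_apply hm hh E).differentiable one_ne_zero
    v).hasFDerivAt.hasLineDerivAt E |>.unique <|
      hasLineDerivAt_transportResolvent hν.continuous hh.contDiff.continuous
        (hν.integrableOn_attenuated hm hh.contDiff.continuous hh.abs_le (E, v))

theorem integral_mul_transportResolvent [MeasurableSpace V] [BorelSpace V] {μ : Measure V}
    [μ.IsAddHaarMeasure] (hmi : Integrable m μ) (hh : IsTransportSource m a h) (E : V) :
    ∫ v, ν v * transportResolvent ν E h v ∂μ = ∫ v, h v ∂μ := by
  obtain ⟨ν₁, ν₂, hν₁, hbd⟩ := hν.bounds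
  have hR := hν.integrable_transportResolvent hm hmi hh E
  have hνR : Integrable (fun v => ν v * transportResolvent ν E h v) μ :=
    hR.bdd_mul (c := ν₂) hν.continuous.aestronglyMeasurable (Eventually.of_forall fun v => by
      rw [Real.norm_of_nonneg (hν₁.le.trans (hbd v).1)]
      exact (hbd v).2)
  have hhi : Integrable h μ := (hmi.const_mul a).mono' hh.contDiff.continuous.aestronglyMeasurable
    (Eventually.of_forall hh.abs_le)
  have hzero : ∫ v, fderiv ℝ (transportResolvent ν E h) v E ∂μ = 0 := by
    have hderiv := (hhi.sub hνR).congr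
      (Eventually.of_forall fun v => (hν.fderiv_transportResolvent_apply hm hh E v).symm)
    simpa using integral_mul_fderiv_eq_neg_fderiv_mul_of_integrable (𝕜 := ℝ) (f := fun _ => 1)
      (by simp) (by simpa using hderiv) (by simpa using hR) (fun _ _ => differentiableAt_const 1)
      (fun v _ => (hν.contDiff_transportResolvent_apply hm hh E).differentiable one_ne_zero v)
  simp only [hν.fderiv_transportResolvent_apply hm hh E] at hzero
  rw [integral_sub hhi hνR] at hzero
  linarith

theorem exists_norm_fderiv_transportResolvent_field_le (R : ℝ) :
    ∃ C, ∀ a h, IsTransportSource m a h → ∀ E, ‖E‖ ≤ R → ∀ v,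
      ‖fderiv ℝ (fun E => transportResolvent ν E h v) E‖ ≤ a * C * (m v / (1 + ‖v‖)) := by
  obtain ⟨C, hC⟩ := hν.exists_norm_fderiv_transportResolvent_le hm R
  refine ⟨C, fun a h hh E hE v => ?_⟩
  have hinl : HasFDerivAt (fun E : V => (E, v)) (ContinuousLinearMap.inl ℝ V V) E :=
    (hasFDerivAt_id E).prodMk (hasFDerivAt_const v E)
  have hjoint := (((hν.contDiff_transportResolvent hm hh).1.differentiable one_ne_zero
    (E, v)).hasFDerivAt).comp E hinl
  have hle : ‖ContinuousLinearMap.inl ℝ V V‖ ≤ 1 := ContinuousLinearMap.norm_inl_le_one ℝ V V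
  refine (congrArg norm hjoint.fderiv).trans_le <|
    (ContinuousLinearMap.opNorm_comp_le _ _).trans ?_
  exact (mul_le_of_le_one_right (norm_nonneg _) hle).trans (hC a h hh (E, v) hE)

theorem isDominatedFamily_transportResolvent {Y : Type*} [TopologicalSpace Y]
    [FirstCountableTopology Y] {H : Y → V → ℝ} (hH : Continuous H.uncurry)
    (hs : ∀ y, IsTransportSource m a (H y)) {w : V → ℝ} (hw : IsModerateWeight w)
    (hmw : ∀ v, m v / (1 + ‖v‖) ≤ w v) {b : ℝ} (hb : ∀ y v, |H y v| ≤ b * w v) :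
    IsDominatedFamily (fun z : V × Y => w z.1) fun E z => transportResolvent ν E (H z.2) z.1 where
  continuous := (hν.continuous_transportResolvent hw hH hb).comp
    ((continuous_fst.prodMk (continuous_fst.comp continuous_snd)).prodMk
      (continuous_snd.comp continuous_snd))
  contDiff z := (hν.contDiff_transportResolvent hm (hs z.2)).1.comp
    (contDiff_id.prodMk contDiff_const)
  bound R := by
    obtain ⟨C, hC⟩ := hν.exists_abs_transportResolvent_le hw R
    obtain ⟨C', hC'⟩ := hν.exists_norm_fderiv_transportResolvent_field_le hm R
    refine ⟨max (b * C) |a * C'|, fun E hE z => ⟨?_, ?_⟩⟩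
    · exact (hC b _ (hb z.2) E hE z.1).trans
        (mul_le_mul_of_nonneg_right (le_max_left _ _) (hw.pos z.1).le)
    · have hmz : 0 ≤ m z.1 / (1 + ‖z.1‖) := div_nonneg (hm.pos z.1).le (by positivity)
      calc _ ≤ a * C' * (m z.1 / (1 + ‖z.1‖)) := hC' a _ (hs z.2) E hE z.1
        _ ≤ |a * C'| * (m z.1 / (1 + ‖z.1‖)) := by gcongr; exact le_abs_self _
        _ ≤ max (b * C) |a * C'| * w z.1 :=
          mul_le_mul (le_max_right _ _) (hmw z.1) hmz ((abs_nonneg _).trans (le_max_right _ _))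

end IsAbsorptionRate

end TransportResolvent

section Boltzmann

variable {d : ℕ} {M : Vel d → ℝ} {σ : Vel d → Vel d → ℝ}

/-- An equilibrium: a positive `C¹` probability density with `|DM| ≤ C M / (1 + |v|)`. Along
straight lines it varies at most polynomially. -/
structure IsEquilibrium (M : Vel d → ℝ) : Prop where
  pos : ∀ v, 0 < M v
  integral_eq_one : (∫ v, M v) = 1
  contDiff : ContDiff ℝ 1 M
  fderiv_bound : ∃ C : ℝ, ∀ v, ‖fderiv ℝ M v‖ ≤ C * (M v / (1 + ‖v‖))

/-- A scattering kernel: symmetric, bounded between two positive constants, and `C¹` in one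
velocity with `|∇_v σ(v', v)| ≤ C / (1 + |v|)`. -/
structure IsScatteringKernel (σ : Vel d → Vel d → ℝ) : Prop where
  symm : ∀ v v', σ v v' = σ v' v
  bounds : ∃ ν₁ ν₂ : ℝ, 0 < ν₁ ∧ ∀ v v', ν₁ ≤ σ v v' ∧ σ v v' ≤ ν₂
  contDiff : ∀ v', ContDiff ℝ 1 (fun v => σ v' v)
  fderiv_bound : ∃ C : ℝ, ∀ v' v, ‖fderiv ℝ (fun w => σ v' w) v‖ ≤ C / (1 + ‖v‖)

/-- The gain operator `f ↦ ∫ σ(·,v') f(v') dv'`; the gain term of the collision operator is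
`M * gain σ f`. -/
noncomputable def gain (σ : Vel d → Vel d → ℝ) (f : Vel d → ℝ) (v : Vel d) : ℝ :=
  ∫ v', σ v v' * f v'

namespace IsEquilibrium

variable (hM : IsEquilibrium M)
include hM

theorem integrable : Integrable M :=
  integrable_of_integral_eq_one hM.integral_eq_one

theorem isModerateWeight : IsModerateWeight M := by
  obtain ⟨C, hC⟩ := hM.fderiv_bound
  exact isModerateWeight_of_norm_fderiv_le hM.pos (hM.contDiff.differentiable one_ne_zero) hC

theorem exists_isTransportSource : ∃ a, IsTransportSource M a M := by
  obtain ⟨C, hC⟩ := hM.fderiv_bound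
  refine ⟨max 1 C, hM.contDiff, fun v => ?_, fun v => (hC v).trans ?_⟩
  · rw [abs_of_pos (hM.pos v)]
    exact le_mul_of_one_le_left (hM.pos v).le (le_max_left _ _)
  · have := hM.pos v
    gcongr
    exact le_max_right _ _

end IsEquilibrium

namespace IsScatteringKernel

variable (hσ : IsScatteringKernel σ)
include hσ

theorem continuous : Continuous σ.uncurry := by
  obtain ⟨C, hC⟩ := hσ.fderiv_bound
  have hC₀ : 0 ≤ C := by simpa using (norm_nonneg _).trans (hC 0 0)
  refine continuous_prod_of_continuous_lipschitzWith' σ.uncurry ⟨C, hC₀⟩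
    (fun u => lipschitzWith_of_nnnorm_fderiv_le
      ((hσ.contDiff u).differentiable one_ne_zero) fun v => ?_)
    fun v => ?_
  · exact (hC u v).trans (div_le_self hC₀ (by linarith [norm_nonneg v]))
  · simpa only [Function.uncurry, hσ.symm _ v] using (hσ.contDiff v).continuous

theorem integrable_mul {f : Vel d → ℝ} (hf : Integrable f) (v : Vel d) :
    Integrable fun v' => σ v v' * f v' := by
  obtain ⟨ν₁, ν₂, hν₁, hbd⟩ := hσ.bounds
  refine hf.bdd_mul (c := ν₂) (hσ.contDiff v).continuous.aestronglyMeasurable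
    (Eventually.of_forall fun v' => ?_)
  rw [Real.norm_of_nonneg (hν₁.le.trans (hbd v v').1)]
  exact (hbd v v').2

theorem collisionFrequency_eq_gain : collisionFrequency M σ = gain σ M := by
  ext v
  simp only [collisionFrequency, gain, hσ.symm v]

theorem integrable_prod_mul {f g : Vel d → ℝ} (hf : Integrable f) (hg : Integrable g) :
    Integrable fun q : Vel d × Vel d => σ q.1 q.2 * (g q.1 * f q.2) := by
  obtain ⟨ν₁, ν₂, hν₁, hbd⟩ := hσ.bounds
  refine (hg.mul_prod hf).bdd_mul (c := ν₂) hσ.continuous.aestronglyMeasurable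
    (Eventually.of_forall fun q => ?_)
  rw [Real.norm_of_nonneg (hν₁.le.trans (hbd q.1 q.2).1)]
  exact (hbd q.1 q.2).2

theorem integrable_gain_mul {f g : Vel d → ℝ} (hf : Integrable f) (hg : Integrable g) :
    Integrable fun v => gain σ f v * g v := by
  refine (hσ.integrable_prod_mul hf hg).integral_prod_left.congr (Eventually.of_forall fun v => ?_)
  simp only [gain, ← integral_mul_const, mul_assoc, mul_comm (g v)]

theorem integral_gain_mul {f g : Vel d → ℝ} (hf : Integrable f) (hg : Integrable g) :
    ∫ v, gain σ f v * g v = ∫ v, gain σ g v * f v := by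
  simp only [gain, ← integral_mul_const]
  calc ∫ v, ∫ v', σ v v' * f v' * g v = ∫ v, ∫ v', σ v v' * (g v * f v') := by
        simp only [mul_assoc, mul_comm (f _)]
    _ = ∫ v', ∫ v, σ v v' * (g v * f v') := integral_integral_swap (hσ.integrable_prod_mul hf hg)
    _ = ∫ v', ∫ v, σ v' v * g v * f v' := by
        simp only [hσ.symm _, mul_assoc]

theorem collision_eq {f : Vel d → ℝ} (hM : Integrable M) (hf : Integrable f) (v : Vel d) :
    collision M σ f v = M v * gain σ f v - collisionFrequency M σ v * f v := by
  have hgain : Integrable fun v' => σ v v' * M v * f v' :=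
    ((hσ.integrable_mul hf v).const_mul (M v)).congr (Eventually.of_forall fun v' => by ring)
  have hloss : Integrable fun v' => σ v' v * M v' * f v := by
    simpa only [hσ.symm v] using (hσ.integrable_mul hM v).mul_const (f v)
  rw [collision, integral_sub hgain hloss, integral_mul_const, collisionFrequency, gain,
    ← integral_const_mul]
  simp only [mul_left_comm (M v), mul_assoc]

theorem collision_sub (hM : Integrable M) {f g : Vel d → ℝ} (hf : Integrable f)
    (hg : Integrable g) : collision M σ (f - g) = collision M σ f - collision M σ g := by
  ext v
  have hgain : gain σ (f - g) v = gain σ f v - gain σ g v := by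
    simp only [gain, Pi.sub_apply, mul_sub]
    exact integral_sub (hσ.integrable_mul hf v) (hσ.integrable_mul hg v)
  simp only [Pi.sub_apply, hσ.collision_eq hM, hf, hg, hf.sub hg, hgain]
  ring

theorem contDiff_gain {f : Vel d → ℝ} (hfc : Continuous f) (hf : Integrable f) :
    ContDiff ℝ 1 (gain σ f) ∧ ∃ B, ∀ v, ‖fderiv ℝ (gain σ f) v‖ ≤ B / (1 + ‖v‖) := by
  obtain ⟨ν₁, ν₂, hν₁, hbd⟩ := hσ.bounds
  obtain ⟨C, hC⟩ := hσ.fderiv_bound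
  have hC₀ : 0 ≤ C := by simpa using (norm_nonneg _).trans (hC 0 0)
  have hsymm u : (fun v => σ v u) = σ u := funext fun v => hσ.symm v u
  have hfderiv v u : ‖fderiv ℝ (fun v => σ v u * f u) v‖ ≤ C / (1 + ‖v‖) * |f u| := by
    rw [fderiv_mul_const (by rw [hsymm]; exact (hσ.contDiff u).differentiable one_ne_zero v),
      norm_smul, hsymm, Real.norm_eq_abs, mul_comm]
    exact mul_le_mul_of_nonneg_right (hC u v) (abs_nonneg _)
  have hgain := contDiff_one_integral_of_continuous (μ := volume) (f := fun v u => σ v u * f u)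
    (hσ.continuous.mul (hfc.comp continuous_snd))
    (Eventually.of_forall fun u => by
      have := (hσ.contDiff u).mul (contDiff_const (c := f u))
      simpa only [hσ.symm u] using this) fun _ =>
    ⟨fun u => (ν₂ + C) * |f u|, hf.abs.const_mul _, Eventually.of_forall fun u v _ => ?_⟩
  · refine ⟨hgain.1, C * ∫ u, |f u|, fun v => ?_⟩
    rw [show gain σ f = fun v => ∫ u, σ v u * f u from rfl, hgain.2 v, mul_div_right_comm,
      ← integral_const_mul]
    exact norm_integral_le_of_norm_le (hf.abs.const_mul _) (Eventually.of_forall (hfderiv v))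
  · have hσ₀ := hν₁.le.trans (hbd v u).1
    constructor
    · rw [abs_mul, abs_of_nonneg hσ₀]
      exact mul_le_mul_of_nonneg_right (by linarith [(hbd v u).2]) (abs_nonneg _)
    · have hdiv : C / (1 + ‖v‖) ≤ C := div_le_self hC₀ (by linarith [norm_nonneg v])
      exact (hfderiv v u).trans
        (mul_le_mul_of_nonneg_right (by linarith [(hbd v u).2]) (abs_nonneg _))

theorem exists_abs_gain_le {f : Vel d → ℝ} (hf : Integrable f) : ∃ b, ∀ v, |gain σ f v| ≤ b := by
  obtain ⟨ν₁, ν₂, hν₁, hbd⟩ := hσ.bounds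
  refine ⟨∫ u, ν₂ * |f u|, fun v => norm_integral_le_of_norm_le (f := fun u => σ v u * f u)
    (hf.abs.const_mul _) (Eventually.of_forall fun u => ?_)⟩
  rw [norm_mul, Real.norm_of_nonneg (hν₁.le.trans (hbd v u).1), Real.norm_eq_abs]
  exact mul_le_mul_of_nonneg_right (hbd v u).2 (abs_nonneg _)

theorem collisionFrequency_mem_Icc (hM : IsEquilibrium M) {ν₁ ν₂ : ℝ}
    (hbd : ∀ v v', ν₁ ≤ σ v v' ∧ σ v v' ≤ ν₂) (v : Vel d) :
    ν₁ ≤ collisionFrequency M σ v ∧ collisionFrequency M σ v ≤ ν₂ := by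
  have hint := hσ.integrable_mul hM.integrable v
  rw [hσ.collisionFrequency_eq_gain, ← mul_one ν₁, ← mul_one ν₂, ← hM.integral_eq_one,
    ← integral_const_mul, ← integral_const_mul]
  exact ⟨integral_mono (hM.integrable.const_mul _) hint fun u =>
      mul_le_mul_of_nonneg_right (hbd v u).1 (hM.pos u).le,
    integral_mono hint (hM.integrable.const_mul _) fun u =>
      mul_le_mul_of_nonneg_right (hbd v u).2 (hM.pos u).le⟩

theorem isAbsorptionRate_collisionFrequency (hM : IsEquilibrium M) :
    IsAbsorptionRate (collisionFrequency M σ) where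
  contDiff := by
    rw [hσ.collisionFrequency_eq_gain]
    exact (hσ.contDiff_gain hM.contDiff.continuous hM.integrable).1
  bounds := by
    obtain ⟨ν₁, ν₂, hν₁, hbd⟩ := hσ.bounds
    exact ⟨ν₁, ν₂, hν₁, hσ.collisionFrequency_mem_Icc hM hbd⟩
  fderiv_bound := by
    rw [hσ.collisionFrequency_eq_gain]
    exact (hσ.contDiff_gain hM.contDiff.continuous hM.integrable).2

theorem integrable_collision (hM : IsEquilibrium M) {f : Vel d → ℝ} (hf : Integrable f) :
    Integrable (collision M σ f) := by
  have hν := hσ.isAbsorptionRate_collisionFrequency hM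
  obtain ⟨ν₁, ν₂, hν₁, hbd⟩ := hν.bounds
  have hgain : Integrable fun v => M v * gain σ f v := by
    simpa only [mul_comm] using hσ.integrable_gain_mul hf hM.integrable
  have hloss : Integrable fun v => collisionFrequency M σ v * f v := by
    refine hf.bdd_mul (c := ν₂) hν.continuous.aestronglyMeasurable
      (Eventually.of_forall fun v => ?_)
    rw [Real.norm_of_nonneg (hν₁.le.trans (hbd v).1)]
    exact (hbd v).2
  exact (hgain.sub hloss).congr
    (Eventually.of_forall fun v => (hσ.collision_eq hM.integrable hf v).symm)

end IsScatteringKernel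

/-- The kernel, in `(v, u)`, of the operator `f ↦ R_E (M (gain σ f - c ∫ f))`, where `R_E` solves
the transport equation `E · ∇F + ν F = h`. A normalized solution of the Boltzmann equation is a
solution `F` of `F = c R_E M + ∫ fieldKernel M σ c E (·, u) F(u) du`. -/
noncomputable def fieldKernel (M : Vel d → ℝ) (σ : Vel d → Vel d → ℝ) (c : ℝ) (E : Vel d)
    (z : Vel d × Vel d) : ℝ :=
  transportResolvent (collisionFrequency M σ) E (fun v => M v * (σ z.2 v - c)) z.1

namespace IsScatteringKernel

variable (hσ : IsScatteringKernel σ) (hM : IsEquilibrium M)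
include hσ hM

theorem exists_isTransportSource_mul_sub (c : ℝ) :
    ∃ a, ∀ u, IsTransportSource M a fun v => M v * (σ u v - c) := by
  obtain ⟨a, ha⟩ := hM.exists_isTransportSource
  obtain ⟨ν₁, ν₂, hν₁, hbd⟩ := hσ.bounds
  obtain ⟨B, hB⟩ := hσ.fderiv_bound
  refine ⟨_, fun u => ha.mul_of_fderiv_le hM.pos ((hσ.contDiff u).sub contDiff_const)
    (b := ν₂ + |c|) (B := B) (fun v => ?_) fun v => ?_⟩
  · refine (abs_sub _ _).trans ?_
    rw [abs_of_nonneg (hν₁.le.trans (hbd u v).1)]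
    exact add_le_add_left (hbd u v).2 _
  · rw [fderiv_sub_const]
    exact hB u v

theorem exists_isTransportSource_mul_gain {f : Vel d → ℝ} (hfc : Continuous f) (hf : Integrable f)
    (c : ℝ) : ∃ a, IsTransportSource M a fun v => M v * (gain σ f v + c) := by
  obtain ⟨a, ha⟩ := hM.exists_isTransportSource
  obtain ⟨b, hb⟩ := hσ.exists_abs_gain_le hf
  obtain ⟨hdiff, B, hB⟩ := hσ.contDiff_gain hfc hf
  exact ⟨_, ha.mul_of_fderiv_le hM.pos (hdiff.add contDiff_const) (b := b + |c|) (B := B)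
    (fun v => (abs_add_le _ _).trans (add_le_add_left (hb v) _)) fun v => by
      rw [fderiv_add_const]
      exact hB v⟩

theorem continuous_mul_sub (c : ℝ) :
    Continuous (Function.uncurry fun u v => M v * (σ u v - c)) :=
  (hM.contDiff.continuous.comp continuous_snd).mul (hσ.continuous.sub continuous_const)

theorem isDominatedFamily_fieldKernel {w : Vel d → ℝ} (hw : IsModerateWeight w)
    (hMw : ∀ v, M v / (1 + ‖v‖) ≤ w v) {c b : ℝ} (hb : ∀ u v, |M v * (σ u v - c)| ≤ b * w v) :
    IsDominatedFamily (fun z : Vel d × Vel d => w z.1) (fieldKernel M σ c) := by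
  obtain ⟨a, ha⟩ := hσ.exists_isTransportSource_mul_sub hM c
  exact (hσ.isAbsorptionRate_collisionFrequency hM).isDominatedFamily_transportResolvent
    hM.isModerateWeight (hσ.continuous_mul_sub hM c) ha hw hMw hb

theorem isDominatedFamily_fieldKernel_equilibrium (c : ℝ) :
    IsDominatedFamily (fun z : Vel d × Vel d => M z.1) (fieldKernel M σ c) := by
  obtain ⟨a, ha⟩ := hσ.exists_isTransportSource_mul_sub hM c
  exact hσ.isDominatedFamily_fieldKernel hM hM.isModerateWeight
    (fun v => div_le_self (hM.pos v).le (by linarith [norm_nonneg v])) fun u => (ha u).abs_le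

theorem isDominatedFamily_mul_transportResolvent (c : ℝ) :
    IsDominatedFamily M fun E v => c * transportResolvent (collisionFrequency M σ) E M v := by
  obtain ⟨a, ha⟩ := hM.exists_isTransportSource
  have hcM : IsTransportSource M (a * |c|) fun v => M v * c := by
    simpa using ha.mul_of_fderiv_le hM.pos (contDiff_const (c := c)) (b := |c|) (B := 0)
      (fun _ => le_rfl) (by simp)
  have hdom := (hσ.isAbsorptionRate_collisionFrequency hM).isDominatedFamily_transportResolvent
    hM.isModerateWeight (Y := Unit) (H := fun _ v => M v * c)
    (hcM.contDiff.continuous.comp continuous_snd) (fun _ => hcM) hM.isModerateWeight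
    (fun v => div_le_self (hM.pos v).le (by linarith [norm_nonneg v])) fun _ => hcM.abs_le
  simpa only [mul_comm _ c, transportResolvent_const_mul] using
    hdom.comp_continuous (Continuous.prodMk_left ())

theorem mul_transportResolvent_add_kernelIntegral (c : ℝ) {F : Vel d → Vel d → ℝ} {E : Vel d}
    (hFc : Continuous (F E)) (hF : Integrable (F E)) (v : Vel d) :
    c * transportResolvent (collisionFrequency M σ) E M v +
        kernelIntegral volume (fieldKernel M σ c) F E v =
      transportResolvent (collisionFrequency M σ) E
        (fun v => M v * (gain σ (F E) v + c * (1 - ∫ u, F E u))) v := by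
  have hν := hσ.isAbsorptionRate_collisionFrequency hM
  obtain ⟨a, ha⟩ := hσ.exists_isTransportSource_mul_sub hM c
  obtain ⟨b, hb⟩ := hσ.exists_isTransportSource_mul_gain hM hFc hF (-(c * ∫ u, F E u))
  have hsource v : ∫ u, M v * (σ u v - c) * F E u =
      M v * (gain σ (F E) v + -(c * ∫ u, F E u)) := by
    simp only [mul_assoc, integral_const_mul, sub_mul, hσ.symm _ v]
    rw [integral_sub (hσ.integrable_mul hF v) (hF.const_mul c), integral_const_mul,
      ← sub_eq_add_neg, gain]
  have hkernel : kernelIntegral volume (fieldKernel M σ c) F E v =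
      transportResolvent (collisionFrequency M σ) E
        (fun v => M v * (gain σ (F E) v + -(c * ∫ u, F E u))) v := by
    simp only [← hsource]
    exact (hν.transportResolvent_integral hM.isModerateWeight (hσ.continuous_mul_sub hM c)
      (fun u => (ha u).abs_le) hF E v).symm
  rw [hkernel, ← transportResolvent_const_mul,
    ← hν.transportResolvent_add hM.isModerateWeight (hM.contDiff.continuous.const_mul c)
      (a := |c|) (fun v => by rw [abs_mul, abs_of_pos (hM.pos v)]) hb.contDiff.continuous
      hb.abs_le]
  congr 1
  ext v
  ring

theorem isUniformContraction_fieldKernel {ν₁ ν₂ : ℝ} (hν₁ : 0 < ν₁)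
    (hbd : ∀ v v', ν₁ ≤ σ v v' ∧ σ v v' ≤ ν₂) :
    IsUniformContraction volume (collisionFrequency M σ) (fieldKernel M σ ν₁) := by
  have hν := hσ.isAbsorptionRate_collisionFrequency hM
  have hνbd := hσ.collisionFrequency_mem_Icc hM hbd
  have hν₂ : 0 < ν₂ := hν₁.trans_le ((hbd 0 0).1.trans (hbd 0 0).2)
  obtain ⟨a, ha⟩ := hσ.exists_isTransportSource_mul_sub hM ν₁
  refine ⟨hν.continuous, hν.bounds, 1 - ν₁ / ν₂,
    sub_nonneg.2 ((div_le_one hν₂).2 ((hbd 0 0).1.trans (hbd 0 0).2)),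
    sub_lt_self _ (div_pos hν₁ hν₂), fun E u => ?_⟩
  have hnonneg v : 0 ≤ fieldKernel M σ ν₁ E (v, u) := transportResolvent_nonneg _ _
    (fun v => mul_nonneg (hM.pos v).le (sub_nonneg.2 (hbd u v).1)) v
  calc ∫ v, collisionFrequency M σ v * |fieldKernel M σ ν₁ E (v, u)|
      = ∫ v, M v * (σ u v - ν₁) := by
        simp only [abs_of_nonneg (hnonneg _)]
        exact hν.integral_mul_transportResolvent hM.isModerateWeight hM.integrable (ha u) E
    _ = collisionFrequency M σ u - ν₁ := by
        simp only [mul_comm (M _), sub_mul]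
        rw [integral_sub (hσ.integrable_mul hM.integrable u) (hM.integrable.const_mul _),
          integral_const_mul, hM.integral_eq_one, mul_one, hσ.collisionFrequency_eq_gain, gain]
    _ ≤ (1 - ν₁ / ν₂) * collisionFrequency M σ u := by
        have : ν₁ / ν₂ * collisionFrequency M σ u ≤ ν₁ :=
          (mul_le_mul_of_nonneg_left (hνbd u).2 (by positivity)).trans_eq
            (div_mul_cancel₀ ν₁ hν₂.ne')
        linarith

end IsScatteringKernel

/-- A mild solution of the stationary equation `E · ∇f - Q(f) = 0`: the equation
`E · ∇f + ν f = M gain σ f`, with `ν` the collision frequency, solved by Duhamel's formula. -/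
def IsMildSolution (M : Vel d → ℝ) (σ : Vel d → Vel d → ℝ) (E : Vel d) (f : Vel d → ℝ) : Prop :=
  ∀ v, f v = transportResolvent (collisionFrequency M σ) E (fun v => M v * gain σ f v) v

namespace IsScatteringKernel

variable (hσ : IsScatteringKernel σ) (hM : IsEquilibrium M)
include hσ hM

/-- Integrating `E · ∇F + ν F = M (gain σ F + c (1 - ∫ F))` leaves only `c (1 - ∫ F) = 0`. -/
theorem integral_eq_one_of_eq_add_kernelIntegral {c : ℝ} (hc : c ≠ 0) {F : Vel d → Vel d → ℝ}
    {E : Vel d} (hFc : Continuous (F E)) (hF : Integrable (F E))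
    (hfix : ∀ v, F E v = c * transportResolvent (collisionFrequency M σ) E M v +
      kernelIntegral volume (fieldKernel M σ c) F E v) :
    ∫ v, F E v = 1 := by
  have hν := hσ.isAbsorptionRate_collisionFrequency hM
  set s := c * (1 - ∫ v, F E v)
  obtain ⟨a, ha⟩ := hσ.exists_isTransportSource_mul_gain hM hFc hF s
  have hresolvent v : F E v = transportResolvent (collisionFrequency M σ) E
      (fun v => M v * (gain σ (F E) v + s)) v :=
    (hfix v).trans (hσ.mul_transportResolvent_add_kernelIntegral hM c hFc hF v)
  have hbalance : ∫ v, gain σ (F E) v * M v = (∫ v, gain σ (F E) v * M v) + s := calc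
    ∫ v, gain σ (F E) v * M v = ∫ v, collisionFrequency M σ v * F E v := by
      rw [hσ.integral_gain_mul hF hM.integrable, hσ.collisionFrequency_eq_gain]
    _ = ∫ v, collisionFrequency M σ v * transportResolvent (collisionFrequency M σ) E
          (fun v => M v * (gain σ (F E) v + s)) v := by simp only [← hresolvent]
    _ = ∫ v, M v * (gain σ (F E) v + s) :=
      hν.integral_mul_transportResolvent hM.isModerateWeight hM.integrable ha E
    _ = ∫ v, (gain σ (F E) v * M v + s * M v) := by simp only [mul_comm (M _), add_mul]
    _ = _ := by
      rw [integral_add (hσ.integrable_gain_mul hF hM.integrable)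
        (hM.integrable.const_mul s), integral_const_mul,
        hM.integral_eq_one, mul_one]
  have hzero : c * (1 - ∫ v, F E v) = 0 := by linarith
  linarith [(mul_eq_zero.1 hzero).resolve_left hc]

theorem isMildSolution_iff_eq_add_kernelIntegral (c : ℝ) {F : Vel d → Vel d → ℝ} {E : Vel d}
    (hFc : Continuous (F E)) (hF : Integrable (F E)) (hone : ∫ v, F E v = 1) :
    IsMildSolution M σ E (F E) ↔ ∀ v, F E v =
      c * transportResolvent (collisionFrequency M σ) E M v +
        kernelIntegral volume (fieldKernel M σ c) F E v := by
  simp only [IsMildSolution, hσ.mul_transportResolvent_add_kernelIntegral hM c hFc hF, hone,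
    sub_self, mul_zero, add_zero]

theorem exists_isDominatedFamily_isMildSolution :
    ∃ F : Vel d → Vel d → ℝ, IsDominatedFamily M F ∧
      (∀ E, ∫ v, F E v = 1 ∧ IsMildSolution M σ E (F E)) ∧
      ∀ R, ∃ c, 0 < c ∧ ∀ E, ‖E‖ ≤ R → ∀ v, c * M v ≤ F E v := by
  have hν := hσ.isAbsorptionRate_collisionFrequency hM
  obtain ⟨ν₁, ν₂, hν₁, hbd⟩ := hσ.bounds
  obtain ⟨F, hF, hfix, hle⟩ := (hσ.isUniformContraction_fieldKernel hM hν₁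
    hbd).exists_eq_add_kernelIntegral (hσ.isDominatedFamily_fieldKernel_equilibrium hM ν₁)
    hM.contDiff.continuous hM.integrable (hσ.isDominatedFamily_mul_transportResolvent hM ν₁)
    (fun E z => transportResolvent_nonneg _ _
      (fun v => mul_nonneg (hM.pos v).le (sub_nonneg.2 (hbd z.2 v).1)) z.1)
    fun E v => mul_nonneg hν₁.le (transportResolvent_nonneg _ _ (fun v => (hM.pos v).le) v)
  have hFi E := hF.integrable_apply hM.integrable E
  have hone E : ∫ v, F E v = 1 := hσ.integral_eq_one_of_eq_add_kernelIntegral hM hν₁.ne'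
    (hF.continuous_apply E) (hFi E) (hfix E)
  refine ⟨F, hF, fun E => ⟨hone E, (hσ.isMildSolution_iff_eq_add_kernelIntegral hM ν₁
    (hF.continuous_apply E) (hFi E) (hone E)).2 (hfix E)⟩, fun R => ?_⟩
  obtain ⟨c, hc, hcR⟩ :=
    hν.exists_le_transportResolvent hM.isModerateWeight hM.contDiff.continuous R
  refine ⟨ν₁ * c, mul_pos hν₁ hc, fun E hE v => le_trans ?_ (hle E v)⟩
  rw [mul_assoc]
  exact mul_le_mul_of_nonneg_left (hcR E hE v) hν₁.le

/-- The choice `c = ν₀` makes `fieldKernel M σ c`, hence the derivative of the integral term, of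
order `M v / (1 + ‖v‖)`. -/
theorem exists_norm_fderiv_field_le
    (hlim : ∃ ν₀ C : ℝ, ∀ v v', |σ v v' - ν₀| ≤ C / (1 + ‖v‖)) {F : Vel d → Vel d → ℝ}
    (hF : IsDominatedFamily M F)
    (hmild : ∀ E, ∫ v, F E v = 1 ∧ IsMildSolution M σ E (F E)) (R : ℝ) :
    ∃ C, ∀ E, ‖E‖ ≤ R → ∀ v, ‖fderiv ℝ (F · v) E‖ ≤ C * (M v / (1 + ‖v‖)) := by
  obtain ⟨ν₀, C, hC⟩ := hlim
  have hν := hσ.isAbsorptionRate_collisionFrequency hM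
  have hw := hM.isModerateWeight.div_one_add_norm
  have hwc : Continuous fun v => M v / (1 + ‖v‖) :=
    hM.contDiff.continuous.div (by fun_prop) fun v => by positivity
  have hint : IsDominatedFamily (fun v => M v / (1 + ‖v‖))
      (kernelIntegral volume (fieldKernel M σ ν₀) F) := by
    refine (hσ.isDominatedFamily_fieldKernel hM hw (fun v => le_rfl) (b := C)
      fun u v => ?_).kernelIntegral hwc hF hM.integrable
    rw [abs_mul, abs_of_pos (hM.pos v), hσ.symm]
    exact (mul_le_mul_of_nonneg_left (hC v u) (hM.pos v).le).trans_eq (by ring)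
  have hsplit v : (F · v) = fun E => ν₀ * transportResolvent (collisionFrequency M σ) E M v +
      kernelIntegral volume (fieldKernel M σ ν₀) F E v := by
    ext E
    exact (hσ.isMildSolution_iff_eq_add_kernelIntegral hM ν₀ (hF.continuous_apply E)
      (hF.integrable_apply hM.integrable E) (hmild E).1).1 (hmild E).2 v
  obtain ⟨a, ha⟩ := hM.exists_isTransportSource
  obtain ⟨B, hB⟩ := hν.exists_norm_fderiv_transportResolvent_field_le hM.isModerateWeight R
  obtain ⟨B', hB'⟩ := hint.bound R
  refine ⟨|ν₀| * (a * B) + B', fun E hE v => ?_⟩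
  have hfield : DifferentiableAt ℝ
      (fun E => transportResolvent (collisionFrequency M σ) E M v) E :=
    ((hν.contDiff_transportResolvent hM.isModerateWeight ha).1.comp
      (contDiff_id.prodMk contDiff_const)).differentiable one_ne_zero E
  rw [hsplit v, fderiv_fun_add (hfield.const_mul _) (hint.differentiableAt v E),
    fderiv_const_mul hfield, add_mul]
  refine (norm_add_le _ _).trans (add_le_add ?_ (hB' E hE v).2)
  rw [norm_smul, Real.norm_eq_abs, mul_assoc]
  exact mul_le_mul_of_nonneg_left (hB a M ha E hE v) (abs_nonneg _)

end IsScatteringKernel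

namespace IsMildSolution

variable {E : Vel d} {f : Vel d → ℝ} (hmild : IsMildSolution M σ E f)
  (hσ : IsScatteringKernel σ) (hM : IsEquilibrium M) (hfc : Continuous f) (hf : Integrable f)
include hmild hσ hM hfc hf

protected theorem contDiff : ContDiff ℝ 1 f := by
  obtain ⟨a, ha⟩ := hσ.exists_isTransportSource_mul_gain hM hfc hf 0
  rw [funext hmild]
  simpa only [add_zero] using (hσ.isAbsorptionRate_collisionFrequency
    hM).contDiff_transportResolvent_apply hM.isModerateWeight ha E

theorem fderiv_apply_eq_collision (v : Vel d) : fderiv ℝ f v E = collision M σ f v := by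
  obtain ⟨a, ha⟩ := hσ.exists_isTransportSource_mul_gain hM hfc hf 0
  have htransport := (hσ.isAbsorptionRate_collisionFrequency
    hM).fderiv_transportResolvent_apply hM.isModerateWeight ha E v
  simp only [add_zero, ← funext hmild] at htransport
  rw [htransport, hσ.collision_eq hM.integrable hf]

theorem isNormalizedSolution (hone : ∫ v, f v = 1) : IsNormalizedSolution M σ E f := by
  refine ⟨hf, hone, fun φ hφ hφs => ?_⟩
  have hφ₁ : ContDiff ℝ 1 φ := hφ.of_le (by exact_mod_cast le_top)
  have hf₁ := hmild.contDiff hσ hM hfc hf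
  have hdf : Continuous fun v => fderiv ℝ f v E :=
    (hf₁.continuous_fderiv one_ne_zero).clm_apply continuous_const
  have hdφ : Continuous fun v => fderiv ℝ φ v E :=
    (hφ₁.continuous_fderiv one_ne_zero).clm_apply continuous_const
  rw [integral_mul_fderiv_eq_neg_fderiv_mul_of_integrable
    ((hdf.mul hφ.continuous).integrable_of_hasCompactSupport hφs.mul_left)
    ((hfc.mul hdφ).integrable_of_hasCompactSupport (hφs.fderiv_apply (𝕜 := ℝ) E).mul_left)
    ((hfc.mul hφ.continuous).integrable_of_hasCompactSupport hφs.mul_left)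
    (fun v _ => hf₁.differentiable one_ne_zero v) fun v _ => hφ₁.differentiable one_ne_zero v]
  simp only [hmild.fderiv_apply_eq_collision hσ hM hfc hf, neg_neg, sub_self]

end IsMildSolution

theorem IsEquilibrium.integrable_sq_div (hM : IsEquilibrium M) {f : Vel d → ℝ} {B : ℝ}
    (hf : Continuous f) (hB : ∀ v, |f v| ≤ B * M v) : Integrable fun v => f v ^ 2 / M v := by
  refine (hM.integrable.const_mul (B ^ 2)).mono' ((hf.pow 2).div hM.contDiff.continuous
    fun v => (hM.pos v).ne').aestronglyMeasurable (Eventually.of_forall fun v => ?_)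
  rw [Real.norm_of_nonneg (div_nonneg (sq_nonneg _) (hM.pos v).le), div_le_iff₀ (hM.pos v),
    ← sq_abs]
  calc |f v| ^ 2 ≤ (B * M v) ^ 2 := by gcongr; exact hB v
    _ = B ^ 2 * M v * M v := by ring

end Boltzmann

theorem integrableOn_exp_neg_mul {τ : ℝ} (hτ : 0 < τ) :
    IntegrableOn (fun t => Real.exp (-(τ * t))) (Set.Ioi 0) := by
  simpa using integrableOn_exp_neg_mul_one_add_pow hτ 0

section WeakTransport

variable {V : Type*} [NormedAddCommGroup V] [MeasurableSpace V] {μ : Measure V} {τ : ℝ}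
  {w h : V → ℝ}

theorem integrable_mul_comp_add [BorelSpace V] (hw : Integrable w μ) {g : V → ℝ} (hg : Continuous g)
    (hgs : HasCompactSupport g) (u : V) : Integrable (fun v => w v * g (v + u)) μ := by
  obtain ⟨C, hC⟩ := hg.bounded_above_of_compact_support hgs
  exact hw.mul_bdd (by fun_prop : Continuous fun v => g (v + u)).aestronglyMeasurable
    (Eventually.of_forall fun v => hC _)

variable [NormedSpace ℝ V]

/-- A weak solution of the transport equation `E · ∇w + τ w = h` with constant absorption `τ`. -/
def IsWeakTransportSolution (μ : Measure V) (τ : ℝ) (E : V) (h w : V → ℝ) : Prop :=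
  ∀ φ : V → ℝ, ContDiff ℝ ∞ φ → HasCompactSupport φ →
    ∫ v, w v * (τ * φ v - fderiv ℝ φ v E) ∂μ = ∫ v, h v * φ v ∂μ

theorem tendsto_exp_mul_integral_mul_comp_add_smul (hτ : 0 < τ) (hw : Integrable w μ)
    {ψ : V → ℝ} (hψ : Continuous ψ) (hψs : HasCompactSupport ψ) (E : V) :
    Tendsto (fun t : ℝ => Real.exp (-(τ * t)) * ∫ v, w v * ψ (v + t • E) ∂μ) atTop (𝓝 0) := by
  obtain ⟨C, hC⟩ := hψ.bounded_above_of_compact_support hψs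
  have hexp : Tendsto (fun t => Real.exp (-(τ * t))) atTop (𝓝 0) :=
    Real.tendsto_exp_neg_atTop_nhds_zero.comp (tendsto_id.const_mul_atTop hτ)
  refine hexp.zero_mul_isBoundedUnder_le (isBoundedUnder_of ⟨∫ v, |w v| * C ∂μ, fun t =>
    norm_integral_le_of_norm_le (hw.abs.mul_const C) (Eventually.of_forall fun v => ?_)⟩)
  rw [norm_mul]
  exact mul_le_mul_of_nonneg_left (hC _) (norm_nonneg _)

variable [BorelSpace V]

theorem hasDerivAt_integral_mul_comp_add_smul (hw : Integrable w μ) {ψ : V → ℝ}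
    (hψ : ContDiff ℝ 1 ψ) (hψs : HasCompactSupport ψ) (E : V) (t : ℝ) :
    HasDerivAt (fun t : ℝ => ∫ v, w v * ψ (v + t • E) ∂μ)
      (∫ v, w v * fderiv ℝ ψ (v + t • E) E ∂μ) t := by
  have hdψ : Continuous fun v => fderiv ℝ ψ v E :=
    (hψ.continuous_fderiv one_ne_zero).clm_apply continuous_const
  have hdψs : HasCompactSupport fun v => fderiv ℝ ψ v E := hψs.fderiv_apply (𝕜 := ℝ) E
  have hint (t : ℝ) := integrable_mul_comp_add hw hψ.continuous hψs (t • E)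
  obtain ⟨C, hC⟩ := hdψ.bounded_above_of_compact_support hdψs
  refine (hasDerivAt_integral_of_dominated_loc_of_deriv_le (bound := fun v => |w v| * C)
    (F' := fun t v => w v * fderiv ℝ ψ (v + t • E) E) univ_mem
    (Eventually.of_forall fun t => (hint t).aestronglyMeasurable) (hint t)
    (integrable_mul_comp_add hw hdψ hdψs (t • E)).aestronglyMeasurable
    (Eventually.of_forall fun v s _ => ?_) (hw.abs.mul_const C)
    (Eventually.of_forall fun v s _ => ?_)).2
  · rw [norm_mul]
    exact mul_le_mul_of_nonneg_left (hC _) (norm_nonneg _)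
  · have hline : HasDerivAt (fun s : ℝ => v + s • E) E s := by
      simpa using ((hasDerivAt_id s).smul_const E).const_add v
    exact ((hψ.differentiable one_ne_zero _).hasFDerivAt.comp_hasDerivAt s hline).const_mul (w v)

theorem IsWeakTransportSolution.sub {E : V} {w' h' : V → ℝ}
    (hweak : IsWeakTransportSolution μ τ E h w) (hweak' : IsWeakTransportSolution μ τ E h' w')
    (hw : Integrable w μ) (hw' : Integrable w' μ) (hh : Integrable h μ) (hh' : Integrable h' μ) :
    IsWeakTransportSolution μ τ E (h - h') (w - w') := by
  intro φ hφ hφs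
  have hdφ : Continuous fun v => τ * φ v - fderiv ℝ φ v E :=
    (hφ.continuous.const_mul τ).sub ((hφ.continuous_fderiv (by simp)).clm_apply continuous_const)
  have hdφs : HasCompactSupport fun v => τ * φ v - fderiv ℝ φ v E :=
    hφs.mul_left.sub (hφs.fderiv_apply (𝕜 := ℝ) E)
  have hpair {g φ : V → ℝ} (hg : Integrable g μ) (hφ : Continuous φ) (hφs : HasCompactSupport φ) :
      Integrable (fun v => g v * φ v) μ := by
    simpa using integrable_mul_comp_add hg hφ hφs 0
  simp only [Pi.sub_apply, sub_mul]
  rw [integral_sub (hpair hw hdφ hdφs) (hpair hw' hdφ hdφs), hweak φ hφ hφs, hweak' φ hφ hφs,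
    integral_sub (hpair hh hφ.continuous hφs) (hpair hh' hφ.continuous hφs)]

theorem IsWeakTransportSolution.integral_comp_add_sub [μ.IsAddRightInvariant] {E : V}
    (hweak : IsWeakTransportSolution μ τ E h w) (hw : Integrable w μ) {ψ : V → ℝ}
    (hψ : ContDiff ℝ ∞ ψ) (hψs : HasCompactSupport ψ) (u : V) :
    τ * ∫ v, w v * ψ (v + u) ∂μ - ∫ v, w v * fderiv ℝ ψ (v + u) E ∂μ =
      ∫ v, h (v - u) * ψ v ∂μ := by
  have hdψ : Continuous fun v => fderiv ℝ ψ v E :=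
    (hψ.continuous_fderiv (by simp)).clm_apply continuous_const
  have htest := hweak (fun v => ψ (v + u)) (hψ.comp (contDiff_id.add contDiff_const))
    (hψs.comp_homeomorph (Homeomorph.addRight u))
  simp only [fderiv_comp_add_right, mul_sub, mul_left_comm _ τ] at htest
  rw [← integral_const_mul, ← integral_sub
    ((integrable_mul_comp_add hw hψ.continuous hψs u).const_mul τ)
    (integrable_mul_comp_add hw hdψ (hψs.fderiv_apply (𝕜 := ℝ) E) u), htest,
    ← integral_sub_right_eq_self _ u]
  simp only [sub_add_cancel]

variable [FiniteDimensional ℝ V] [μ.IsAddHaarMeasure]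

theorem integrable_exp_mul_comp_sub_smul (hτ : 0 < τ) (hh : Integrable h μ) (E : V) :
    Integrable (fun q : ℝ × V => Real.exp (-(τ * q.1)) * h (q.2 - q.1 • E))
      ((volume.restrict (Set.Ioi 0)).prod μ) := by
  have hshear : MeasurePreserving (fun q : ℝ × V => (q.1, q.2 - q.1 • E))
      ((volume.restrict (Set.Ioi 0)).prod μ) ((volume.restrict (Set.Ioi 0)).prod μ) :=
    (MeasurePreserving.id _).skew_product (g := fun t v => v - t • E)
      (by fun_prop) (Eventually.of_forall fun t => (measurePreserving_sub_right μ (t • E)).map_eq)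
  exact hshear.integrable_comp_of_integrable ((integrableOn_exp_neg_mul hτ).mul_prod hh)

theorem integrable_exp_mul_comp_sub_smul_mul (hτ : 0 < τ) (hh : Integrable h μ) (E : V)
    {ψ : V → ℝ} (hψ : Continuous ψ) (hψs : HasCompactSupport ψ) :
    Integrable (fun q : ℝ × V => Real.exp (-(τ * q.1)) * h (q.2 - q.1 • E) * ψ q.2)
      ((volume.restrict (Set.Ioi 0)).prod μ) := by
  obtain ⟨C, hC⟩ := hψ.bounded_above_of_compact_support hψs
  exact (integrable_exp_mul_comp_sub_smul hτ hh E).mul_bdd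
    (hψ.comp continuous_snd).aestronglyMeasurable (Eventually.of_forall fun q => hC q.2)

namespace IsWeakTransportSolution

/-- The function `t ↦ exp (-τ t) ∫ w(v) ψ(v + t E) dv` has derivative
`- exp (-τ t) ∫ h(v) ψ(v + t E) dv` by the weak equation, and vanishes at infinity. -/
theorem integral_mul_eq {E : V} (hweak : IsWeakTransportSolution μ τ E h w)
    (hτ : 0 < τ) (hw : Integrable w μ) (hh : Integrable h μ) {ψ : V → ℝ} (hψ : ContDiff ℝ ∞ ψ)
    (hψs : HasCompactSupport ψ) :
    ∫ v, w v * ψ v ∂μ = ∫ t in Set.Ioi 0, ∫ v, Real.exp (-(τ * t)) * h (v - t • E) * ψ v ∂μ := by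
  have hderiv (t : ℝ) : HasDerivAt (fun t => Real.exp (-(τ * t)) * ∫ v, w v * ψ (v + t • E) ∂μ)
      (-∫ v, Real.exp (-(τ * t)) * h (v - t • E) * ψ v ∂μ) t := by
    have hexp : HasDerivAt (fun t => Real.exp (-(τ * t))) (Real.exp (-(τ * t)) * -τ) t := by
      simpa using ((hasDerivAt_id t).const_mul τ).neg.exp
    refine (hexp.mul (hasDerivAt_integral_mul_comp_add_smul hw (hψ.of_le (by simp)) hψs E
      t)).congr_deriv ?_
    simp only [mul_assoc, integral_const_mul, ← hweak.integral_comp_add_sub hw hψ hψs]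
    ring
  have hftc := integral_Ioi_of_hasDerivAt_of_tendsto' (fun t _ => hderiv t)
    (integrable_exp_mul_comp_sub_smul_mul hτ hh E hψ.continuous hψs).integral_prod_left.neg
    (tendsto_exp_mul_integral_mul_comp_add_smul hτ hw hψ.continuous hψs E)
  rw [integral_neg] at hftc
  simpa using hftc.symm

theorem ae_eq {E : V} (hweak : IsWeakTransportSolution μ τ E h w)
    (hτ : 0 < τ) (hw : Integrable w μ) (hh : Integrable h μ) :
    w =ᵐ[μ] fun v => ∫ t in Set.Ioi 0, Real.exp (-(τ * t)) * h (v - t • E) := by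
  have hprod := integrable_exp_mul_comp_sub_smul hτ hh E
  refine ae_eq_of_integral_contDiff_smul_eq hw.locallyIntegrable
    hprod.integral_prod_right.locallyIntegrable fun ψ hψ hψs => ?_
  simp only [smul_eq_mul, mul_comm (ψ _), ← integral_mul_const]
  rw [hweak.integral_mul_eq hτ hw hh hψ hψs]
  exact integral_integral_swap
    (integrable_exp_mul_comp_sub_smul_mul hτ hh E hψ.continuous hψs)

theorem mul_integral_abs_le {E : V}
    (hweak : IsWeakTransportSolution μ τ E h w) (hτ : 0 < τ) (hw : Integrable w μ)
    (hh : Integrable h μ) : τ * ∫ v, |w v| ∂μ ≤ ∫ v, |h v| ∂μ := by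
  have hprod := integrable_exp_mul_comp_sub_smul hτ hh.abs E
  have hle : ∫ v, |w v| ∂μ ≤
      ∫ v, (∫ t in Set.Ioi 0, Real.exp (-(τ * t)) * |h (v - t • E)|) ∂μ := by
    refine integral_mono_ae hw.abs hprod.integral_prod_right ?_
    filter_upwards [hweak.ae_eq hτ hw hh] with v hv
    rw [hv]
    refine (abs_integral_le_integral_abs).trans_eq ?_
    simp only [abs_mul, Real.abs_exp]
  have hswap : ∫ v, (∫ t in Set.Ioi 0, Real.exp (-(τ * t)) * |h (v - t • E)|) ∂μ =
      τ⁻¹ * ∫ v, |h v| ∂μ := by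
    rw [← integral_integral_swap hprod]
    simp only [integral_const_mul, integral_sub_right_eq_self (fun v => |h v|), integral_mul_const,
      ← neg_mul]
    rw [integral_exp_mul_Ioi (neg_lt_zero.2 hτ)]
    simp
  rw [hswap] at hle
  exact (le_inv_mul_iff₀ hτ).1 hle

end IsWeakTransportSolution

end WeakTransport

variable {d : ℕ} {α : ℝ} {M : Vel d → ℝ} {σ : Vel d → Vel d → ℝ}

theorem IsNormalizedSolution.isWeakTransportSolution {E : Vel d} {f : Vel d → ℝ}
    (hf : IsNormalizedSolution M σ E f) (hQ : Integrable (collision M σ f)) (τ : ℝ) :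
    IsWeakTransportSolution volume τ E (fun v => τ * f v + collision M σ f v) f := by
  intro φ hφ hφs
  have hdφ : Continuous fun v => fderiv ℝ φ v E :=
    (hφ.continuous_fderiv (by simp)).clm_apply continuous_const
  have hdφs : HasCompactSupport fun v => fderiv ℝ φ v E := hφs.fderiv_apply (𝕜 := ℝ) E
  have hpair {g ψ : Vel d → ℝ} (hg : Integrable g) (hψ : Continuous ψ)
      (hψs : HasCompactSupport ψ) : Integrable fun v => g v * ψ v := by
    simpa using integrable_mul_comp_add hg hψ hψs 0
  have hτφ : Integrable fun v => τ * (f v * φ v) :=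
    (hpair hf.integrable hφ.continuous hφs).const_mul τ
  simp only [mul_sub, add_mul, mul_assoc, mul_left_comm (f _) τ]
  rw [integral_sub hτφ (hpair hf.integrable hdφ hdφs),
    integral_add hτφ (hpair hQ hφ.continuous hφs)]
  linarith [hf.equation φ hφ hφs]

namespace IsScatteringKernel

variable (hσ : IsScatteringKernel σ)
include hσ

theorem abs_gain_le_sub_of_integral_eq_zero {ν₁ : ℝ} (hbd : ∀ v v', ν₁ ≤ σ v v')
    {w : Vel d → ℝ} (hw : Integrable w) (hzero : ∫ v, w v = 0) (v : Vel d) :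
    |gain σ w v| ≤ gain σ (|w ·|) v - ν₁ * ∫ u, |w u| := by
  have hshift : gain σ w v = ∫ u, (σ v u - ν₁) * w u := by
    simp only [sub_mul]
    rw [integral_sub (hσ.integrable_mul hw v) (hw.const_mul ν₁), integral_const_mul, hzero,
      mul_zero, sub_zero, gain]
  have hσw := hσ.integrable_mul hw.abs v
  rw [hshift, gain, ← integral_const_mul, ← integral_sub hσw (hw.abs.const_mul ν₁)]
  refine norm_integral_le_of_norm_le (f := fun u => (σ v u - ν₁) * w u)
    (hσw.sub (hw.abs.const_mul ν₁)) (Eventually.of_forall fun u => ?_)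
  rw [norm_mul, Real.norm_of_nonneg (sub_nonneg.2 (hbd v u)), Real.norm_eq_abs, sub_mul]

theorem abs_mul_add_collision_le (hM : IsEquilibrium M) {ν₁ ν₂ : ℝ}
    (hbd : ∀ v v', ν₁ ≤ σ v v' ∧ σ v v' ≤ ν₂) {w : Vel d → ℝ} (hw : Integrable w)
    (hzero : ∫ v, w v = 0) (v : Vel d) :
    |ν₂ * w v + collision M σ w v| ≤
      (ν₂ * |w v| - gain σ M v * |w v|) +
        (gain σ (|w ·|) v * M v - ν₁ * (∫ u, |w u|) * M v) := by
  have hν := (hσ.collisionFrequency_mem_Icc hM hbd v).2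
  rw [hσ.collisionFrequency_eq_gain] at hν
  have hMv := (hM.pos v).le
  calc |ν₂ * w v + collision M σ w v|
      = |(ν₂ - gain σ M v) * w v + M v * gain σ w v| := by
        rw [hσ.collision_eq hM.integrable hw, hσ.collisionFrequency_eq_gain]
        ring_nf
    _ ≤ (ν₂ - gain σ M v) * |w v| + M v * |gain σ w v| := by
        refine (abs_add_le _ _).trans_eq ?_
        rw [abs_mul, abs_mul, abs_of_nonneg (sub_nonneg.2 hν), abs_of_nonneg hMv]
    _ ≤ (ν₂ - gain σ M v) * |w v| + M v * (gain σ (|w ·|) v - ν₁ * ∫ u, |w u|) := by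
        gcongr
        exact hσ.abs_gain_le_sub_of_integral_eq_zero (fun v v' => (hbd v v').1) hw hzero v
    _ = _ := by ring

/-- The loss of the factor `ν₁` comes from the part `ν₁ M (∫ w) = 0` of the gain. -/
theorem integral_abs_mul_add_collision_le (hM : IsEquilibrium M) {ν₁ ν₂ : ℝ}
    (hbd : ∀ v v', ν₁ ≤ σ v v' ∧ σ v v' ≤ ν₂) {w : Vel d → ℝ} (hw : Integrable w)
    (hzero : ∫ v, w v = 0) :
    ∫ v, |ν₂ * w v + collision M σ w v| ≤ (ν₂ - ν₁) * ∫ v, |w v| := by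
  set m := ∫ v, |w v|
  have hgain := hσ.integrable_gain_mul hw.abs hM.integrable
  have hloss := hσ.integrable_gain_mul hM.integrable hw.abs
  have hν₂ : Integrable fun v => ν₂ * |w v| := hw.abs.const_mul ν₂
  have hν₁ : Integrable fun v => ν₁ * m * M v := hM.integrable.const_mul _
  have hleft : Integrable fun v => ν₂ * |w v| - gain σ M v * |w v| := hν₂.sub hloss
  have hright : Integrable fun v => gain σ (|w ·|) v * M v - ν₁ * m * M v := hgain.sub hν₁
  calc ∫ v, |ν₂ * w v + collision M σ w v|
      ≤ ∫ v, ((ν₂ * |w v| - gain σ M v * |w v|) + (gain σ (|w ·|) v * M v - ν₁ * m * M v)) :=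
        integral_mono ((hw.const_mul ν₂).add (hσ.integrable_collision hM hw)).abs
          (hleft.add hright) (hσ.abs_mul_add_collision_le hM hbd hw hzero)
    _ = (ν₂ - ν₁) * m := by
      rw [integral_add hleft hright, integral_sub hν₂ hloss, integral_sub hgain hν₁,
        integral_const_mul, integral_const_mul, hM.integral_eq_one,
        hσ.integral_gain_mul hw.abs hM.integrable]
      ring

end IsScatteringKernel

theorem IsNormalizedSolution.ae_eq {E : Vel d} {f g : Vel d → ℝ}
    (hf : IsNormalizedSolution M σ E f) (hg : IsNormalizedSolution M σ E g)
    (hσ : IsScatteringKernel σ) (hM : IsEquilibrium M) : f =ᵐ[volume] g := by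
  obtain ⟨ν₁, ν₂, hν₁, hbd⟩ := hσ.bounds
  have hν₂ : 0 < ν₂ := hν₁.trans_le ((hbd 0 0).1.trans (hbd 0 0).2)
  have hQ {f : Vel d → ℝ} (hf : Integrable f) : Integrable fun v => ν₂ * f v + collision M σ f v :=
    (hf.const_mul ν₂).add (hσ.integrable_collision hM hf)
  have hw : Integrable (f - g) := hf.integrable.sub hg.integrable
  have hzero : ∫ v, (f - g) v = 0 := by
    rw [integral_sub' hf.integrable hg.integrable, hf.integral_eq_one, hg.integral_eq_one, sub_self]
  have hsource : ((fun v => ν₂ * f v + collision M σ f v) - fun v => ν₂ * g v + collision M σ g v) =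
      fun v => ν₂ * (f - g) v + collision M σ (f - g) v := by
    ext v
    simp only [hσ.collision_sub hM.integrable hf.integrable hg.integrable, Pi.sub_apply]
    ring
  have hweak := (hf.isWeakTransportSolution (hσ.integrable_collision hM hf.integrable) ν₂).sub
    (hg.isWeakTransportSolution (hσ.integrable_collision hM hg.integrable) ν₂)
    hf.integrable hg.integrable (hQ hf.integrable) (hQ hg.integrable)
  rw [hsource] at hweak
  have hle := (hweak.mul_integral_abs_le hν₂ hw (hQ hw)).trans
    (hσ.integral_abs_mul_add_collision_le hM hbd hw hzero)
  have hnonneg : 0 ≤ ∫ v, |(f - g) v| := integral_nonneg fun v => abs_nonneg _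
  have habs : ∫ v, |(f - g) v| = 0 := by nlinarith
  filter_upwards [(integral_eq_zero_iff_of_nonneg (fun v => abs_nonneg _) hw.abs).1 habs] with v hv
  exact sub_eq_zero.1 (abs_eq_zero.1 hv)

theorem IsHeavyTailEquilibrium.isEquilibrium (hM : IsHeavyTailEquilibrium α M) :
    IsEquilibrium M where
  pos := hM.pos
  integral_eq_one := hM.integral_eq_one
  contDiff := contDiff_one_iff_fderiv.2 ⟨hM.differentiable, hM.differentiable_fderiv.continuous⟩
  fderiv_bound := hM.fderiv_bound

theorem IsCrossSection.isScatteringKernel (hσ : IsCrossSection M σ) : IsScatteringKernel σ where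
  symm := hσ.symm
  bounds := hσ.bounds
  contDiff := hσ.contDiff
  fderiv_bound := hσ.fderiv_bound

end LinearBoltzmann

open LinearBoltzmann in
theorem theorem2p2_general {d : ℕ} {M : Vel d → ℝ} {σ : Vel d → Vel d → ℝ}
    (hM : IsEquilibrium M) (hσ : IsScatteringKernel σ)
    (hlim : ∃ ν₀ C : ℝ, ∀ v v', |σ v v' - ν₀| ≤ C / (1 + ‖v‖)) :
    ∃ F : Vel d → Vel d → ℝ,
      (∀ E : Vel d,
        ContDiff ℝ 1 (fun v => F v E) ∧
        Integrable (fun v => F v E ^ 2 / M v) ∧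
        (∀ v, fderiv ℝ (fun w => F w E) v E - collision M σ (fun w => F w E) v = 0) ∧
        IsNormalizedSolution M σ E (fun v => F v E) ∧
        ∀ f : Vel d → ℝ, IsNormalizedSolution M σ E f → f =ᵐ[volume] fun v => F v E) ∧
      (∀ R : ℝ, 0 < R → ∃ c C : ℝ, 0 < c ∧ 0 < C ∧
        ∀ E : Vel d, ‖E‖ ≤ R → ∀ v, c * M v ≤ F v E ∧ F v E ≤ C * M v) ∧
      (∀ v, ContDiff ℝ 1 (fun E => F v E)) ∧
      (∀ R : ℝ, 0 < R → ∃ C : ℝ, 0 < C ∧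
        ∀ v E : Vel d, ‖E‖ ≤ R →
          ‖fderiv ℝ (fun E' => F v E') E‖ ≤ C * (F v E / (1 + ‖v‖))) := by
  obtain ⟨F, hF, hsol, hlower⟩ := hσ.exists_isDominatedFamily_isMildSolution hM
  have hFc E := hF.continuous_apply E
  have hFi E := hF.integrable_apply hM.integrable E
  have hnorm E := (hsol E).2.isNormalizedSolution hσ hM (hFc E) (hFi E) (hsol E).1
  refine ⟨fun v E => F E v, fun E => ⟨(hsol E).2.contDiff hσ hM (hFc E) (hFi E), ?_, fun v =>
    sub_eq_zero.2 ((hsol E).2.fderiv_apply_eq_collision hσ hM (hFc E) (hFi E) v), hnorm E,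
    fun f hf => hf.ae_eq (hnorm E) hσ hM⟩, fun R _ => ?_, hF.contDiff, fun R _ => ?_⟩
  · obtain ⟨B, hB⟩ := hF.bound ‖E‖
    exact hM.integrable_sq_div (hFc E) fun v => (hB E le_rfl v).1
  · obtain ⟨c, hc, hcR⟩ := hlower R
    obtain ⟨B, hB⟩ := hF.bound R
    exact ⟨c, max 1 B, hc, by positivity, fun E hE v => ⟨hcR E hE v,
      (le_abs_self _).trans ((hB E hE v).1.trans
        (mul_le_mul_of_nonneg_right (le_max_right _ _) (hM.pos v).le))⟩⟩
  · obtain ⟨c, hc, hcR⟩ := hlower R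
    obtain ⟨C, hC⟩ := hσ.exists_norm_fderiv_field_le hM hlim hF hsol R
    refine ⟨max 1 C / c, by positivity, fun v E hE => (hC E hE v).trans ?_⟩
    have := (hM.pos v).le
    calc C * (M v / (1 + ‖v‖)) ≤ max 1 C * (M v / (1 + ‖v‖)) := by
          gcongr
          exact le_max_right _ _
      _ = max 1 C / c * (c * M v / (1 + ‖v‖)) := by field_simp
      _ ≤ max 1 C / c * (F E v / (1 + ‖v‖)) := by
          gcongr
          exact hcR E hE v

theorem theorem2p2 (d : ℕ) (α : ℝ) (hα₁ : 1 ≤ α) (hα₂ : α < 2)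
    (M : LinearBoltzmann.Vel d → ℝ)
    (σ : LinearBoltzmann.Vel d → LinearBoltzmann.Vel d → ℝ)
    (hM : LinearBoltzmann.IsHeavyTailEquilibrium α M)
    (hσ : LinearBoltzmann.IsCrossSection M σ) :
    ∃ F : LinearBoltzmann.Vel d → LinearBoltzmann.Vel d → ℝ,
      -- (i) existence of a solution, and uniqueness among all distributional solutions
      (∀ E : LinearBoltzmann.Vel d,
        ContDiff ℝ 1 (fun v => F v E) ∧
        Integrable (fun v => F v E ^ 2 / M v) ∧
        (∀ v, fderiv ℝ (fun w => F w E) v E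
          - LinearBoltzmann.collision M σ (fun w => F w E) v = 0) ∧
        LinearBoltzmann.IsNormalizedSolution M σ E (fun v => F v E) ∧
        ∀ f : LinearBoltzmann.Vel d → ℝ, LinearBoltzmann.IsNormalizedSolution M σ E f →
          f =ᵐ[volume] fun v => F v E) ∧
      -- (ii) two-sided comparison with the equilibrium
      (∀ R : ℝ, 0 < R → ∃ c C : ℝ, 0 < c ∧ 0 < C ∧
        ∀ E : LinearBoltzmann.Vel d, ‖E‖ ≤ R → ∀ v, c * M v ≤ F v E ∧ F v E ≤ C * M v) ∧
      -- (iii) regularity with respect to the field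
      (∀ v, ContDiff ℝ 1 (fun E => F v E)) ∧
      (∀ R : ℝ, 0 < R → ∃ C : ℝ, 0 < C ∧
        ∀ v E : LinearBoltzmann.Vel d, ‖E‖ ≤ R →
          ‖fderiv ℝ (fun E' => F v E') E‖ ≤ C * (F v E / (1 + ‖v‖))) := by
  exact theorem2p2_general hM.isEquilibrium hσ.isScatteringKernel hσ.limit
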